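/- Fix integers $m\ge 2$ and $k\ge 1$. For $l\ge 0$ let $I_l$ be the set of words of length $l$ over $\{1,\dots,m\}$ (with $I_0=\{\emptyset\}$), let $I=\bigcup_{l\ge0} I_l$, and let $I_\infty$ be the space of infinite words. Write $|\mathbf i|$ for the length of $\mathbf i$, $\mathbf i\preceq\mathbf j$ if $\mathbf i$ is an initial segment of $\mathbf j$, $\mathbf i\wedge\mathbf j$ for the longest common initial segment, and $C_{\mathbf v}=\{\mathbf x\in I_\infty:\mathbf v\preceq\mathbf x\}$. Let $T_k$ be the rooted tree with vertex set $\bigcup_{l=0}^k I_l$, root $\emptyset$, and edges joining each $\mathbf i$ with $|\mathbf i|<k$ to its children $\mathbf i1,\dots,\mathbf im$. Let $\{W_{\mathbf i}:\mathbf i\in I\}$ be independent, almost surely strictly positive random variables on a probability space, with $\mathbb E(W_{\mathbf i})=1$ for all $\mathbf i$, and let $\mu$ be a Borel probability measure on $I_\infty$. For $\mathbf v=(v_1,\dots,v_l)\in I$ put $$X_{\mathbf v}=W_{v_1}W_{v_1v_2}\cdots W_{v_1\cdots v_l}\quad (X_\emptyset=1),\qquad Y_{\mathbf v}=X_{\mathbf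 v}\,\mu(C_{\mathbf v}).$$ For $\mathbf i_1,\dots,\mathbf i_n\in I_k$ (repetitions allowed) let $T(\mathbf i_1,\dots,\mathbf i_n)$ be the minimal subtree of $T_k$ with root $\emptyset$ containing $\mathbf i_1,\dots,\mathbf i_n$, and for $\mathbf j\in I_k$ let $\mathbf j\wedge T(\mathbf i_1,\dots,\mathbf i_n)$ be the longest initial segment of $\mathbf j$ lying in $T(\mathbf i_1,\dots,\mathbf i_n)$. Let $$S^+(n)=\{(\mathbf i_1,\dots,\mathbf i_n;\mathbf p):\mathbf i_1,\dots,\mathbf i_n\in I_k,\ \mathbf p\in T(\mathbf i_1,\dots,\mathbf i_n)\},$$ and for $J\in S^+(n)$ let $[J]$ be its class under the equivalence relation for which $(\mathbf i_1,\dots,\mathbf i_n;\mathbf p)$ and $(\mathbf i'_1,\dots,\mathbf i'_n;\mathbf p')$ are equivalent if some automorphism $g$ of the rooted tree $T_k$ satisfies $g(\mathbf i_r)=\mathbf i'_r$ for all $r$ and $g(\mathbf p)=\mathbf p'$. For $J=(\mathbf i_1,\dots,\mathbf i_n;\mathbf p)$ let $L(J)$ be the multiset of levels $|\mathbf w|$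 of the join points $\mathbf w=\mathbf i_r\wedge\mathbf i_s$ $(r\ne s)$, where $\mathbf w$ is counted with multiplicity $a$ if $a+1$ is the largest size of a set of indices $A\subseteq\{1,\dots,n\}$ such that $\mathbf i_r\wedge\mathbf i_s=\mathbf w$ for all distinct $r,s\in A$; and let $l_0(J)=|\mathbf p|$. **Proposition.** Let $q=n+\varepsilon>1$ with $n$ a nonnegative integer (so that in fact $n\ge 1$) and $0\le\varepsilon<1$, and let $J\in S^+(n)$. Then $L(J)$ has exactly $n-1$ elements, counted with multiplicity, and $$\sum_{(\mathbf i_1,\dots,\mathbf i_n;\mathbf p)\in[J]}\mathbb E\Big(Y_{\mathbf i_1}\cdots Y_{\mathbf i_n}\Big(\sum_{\substack{\mathbf j\in I_k\\ \mathbf j\wedge T(\mathbf i_1,\dots,\mathbf i_n)=\mathbf p}}Y_{\mathbf j}\Big)^{\varepsilon}\Big)\le\prod_{l\in L(J)}\Big(\sum_{|\mathbf u|=l}\mathbb E(Y_{\mathbf u}^q)\Big)^{1/(q-1)}\cdot\Big(\sum_{|\mathbf u|=l_0(J)}\mathbb E(Y_{\mathbf u}^q)\Big)^{\varepsilon/(q-1)},$$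 where the product is taken with multiplicity, expectations take values in $[0,\infty]$, and when $\varepsilon=0$ the two factors with exponent $\varepsilon$ and $\varepsilon/(q-1)$ are equal to $1$. -/

import Mathlib

open MeasureTheory ProbabilityTheory

open scoped ENNReal

namespace Cascade

/-- A finite word over the `m` symbols, i.e. a vertex of the infinite `m`-ary rooted tree. The empty
word is the root, `List.length` is the level, and `v <+: w` says that `v` is a curtailment of `w`. -/
abbrev Word (m : ℕ) : Type := List (Fin m)

/-- The words of length exactly `k`. -/
abbrev Level (m k : ℕ) : Type := List.Vector (Fin m) k

/-- The vertices of the finite tree `T_k`: the words of length at most `k`. -/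
abbrev Vertex (m k : ℕ) : Type := {w : Word m // w.length ≤ k}

noncomputable instance (m k : ℕ) : Fintype (Vertex m k) :=
  (List.finite_length_le (Fin m) k).fintype

/-- The root of `T_k`. -/
def root (m k : ℕ) : Vertex m k := ⟨[], Nat.zero_le k⟩

/-- A word of length `k`, as a bottom vertex of `T_k`. -/
def Level.toVertex {m k : ℕ} (i : Level m k) : Vertex m k := ⟨i.toList, le_of_eq i.toList_length⟩

/-- The tree `T_k` as a graph: the edges join each vertex to its children. -/
def treeGraph (m k : ℕ) : SimpleGraph (Vertex m k) :=
  SimpleGraph.fromRel fun u v => ∃ a : Fin m, v.1 = u.1 ++ [a]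

/-- `meet i j` is the maximal common curtailment `i ∧ j`. -/
def meet {m : ℕ} : Word m → Word m → Word m
  | a :: i, b :: j => if a = b then a :: meet i j else []
  | _, _ => []

/-- The vertex set of the minimal subtree, rooted at the empty word, that contains the given
vertices: it is made of the paths from the root to these vertices. -/
def spanTree {m k n : ℕ} (i : Fin n → Level m k) : Set (Word m) :=
  {w | w = [] ∨ ∃ r, w <+: (i r).toList}

open Classical in
/-- `meetTree j i` is `j ∧ T(i_1, …, i_n)`: the curtailment `j|s` for the largest `s` such that `j|s`
belongs to `T(i_1, …, i_n)`. -/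
noncomputable def meetTree {m k n : ℕ} (j : Word m) (i : Fin n → Level m k) : Word m :=
  j.take (Nat.findGreatest (fun s => j.take s ∈ spanTree i) j.length)

/-- The set `S⁺(n)` of all `(i_1, …, i_n; p)`, where `i_1, …, i_n` are words of length `k` and `p` is a
vertex of `T(i_1, …, i_n)`. -/
abbrev MarkedTuple (m k n : ℕ) : Type :=
  {J : (Fin n → Level m k) × Vertex m k // J.2.1 ∈ spanTree J.1}

namespace MarkedTuple

variable {m k n : ℕ}

/-- The `n`-tuple of bottom vertices. -/
def leaves (J : MarkedTuple m k n) : Fin n → Level m k := J.1.1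

/-- The marked vertex. -/
def mark (J : MarkedTuple m k n) : Vertex m k := J.1.2

/-- Equivalence under the automorphisms of the rooted tree `T_k`. -/
def Equivalent (J K : MarkedTuple m k n) : Prop :=
  ∃ g : treeGraph m k ≃g treeGraph m k, g (root m k) = root m k ∧
    (∀ r, g (J.leaves r).toVertex = (K.leaves r).toVertex) ∧ g J.mark = K.mark

open Classical in
/-- The equivalence class `[J]`. -/
noncomputable def orbit (J : MarkedTuple m k n) : Finset (MarkedTuple m k n) :=
  Finset.univ.filter fun K => J.Equivalent K

end MarkedTuple

/-- The multiplicity of `w` as a join point of `(i_1, …, i_n)`: the largest `a` such that there are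
`a + 1` distinct indices whose words have pairwise meet `w`. -/
def joinMultiplicity {m k n : ℕ} (i : Fin n → Level m k) (w : Word m) : ℕ :=
  ((Finset.univ : Finset (Finset (Fin n))).filter fun A =>
    ∀ r ∈ A, ∀ s ∈ A, r ≠ s → meet (i r).toList (i s).toList = w).sup Finset.card - 1

/-- The join set of `(i_1, …, i_n)`: the meets `i_r ∧ i_s` with `r ≠ s`, counted by multiplicity. -/
def joinSet {m k n : ℕ} (i : Fin n → Level m k) : Multiset (Word m) :=
  ∑ w ∈ (Finset.univ : Finset (Fin n)).offDiag.image
      (fun rs => meet (i rs.1).toList (i rs.2).toList),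
    Multiset.replicate (joinMultiplicity i w) w

/-- The join levels of `(i_1, …, i_n)`, repeated according to multiplicity. -/
def joinLevels {m k n : ℕ} (i : Fin n → Level m k) : Multiset ℕ :=
  (joinSet i).map List.length

/-- The cylinder of all infinite words of which `v` is a curtailment. -/
def cylinder {m : ℕ} (v : Word m) : Set (ℕ → Fin m) :=
  {x | ∀ r : Fin v.length, x r = v.get r}

section Random

variable {m : ℕ} {Ω : Type*}

/-- `X_{i_1 … i_k} = W_{i_1} W_{i_1 i_2} ⋯ W_{i_1 … i_k}`. -/
def X (W : Word m → Ω → ℝ) (v : Word m) (ω : Ω) : ℝ :=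
  ∏ r ∈ Finset.range v.length, W (v.take (r + 1)) ω

/-- `Y_v = X_v μ(C_v)`. -/
noncomputable def Y (W : Word m → Ω → ℝ) (μ : Measure (ℕ → Fin m)) (v : Word m) (ω : Ω) : ℝ :=
  X W v ω * μ.real (cylinder v)

/-- The expectation, in `[0, ∞]`, of a nonnegative random variable. -/
noncomputable def expect [MeasurableSpace Ω] (P : Measure Ω) (f : Ω → ℝ) : ℝ≥0∞ :=
  ∫⁻ ω, ENNReal.ofReal (f ω) ∂P

/-- The sum of `E(Y_u ^ q)` over all words `u` of length `l`. -/
noncomputable def levelMoment [MeasurableSpace Ω] (P : Measure Ω) (W : Word m → Ω → ℝ)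
    (μ : Measure (ℕ → Fin m)) (q : ℝ) (l : ℕ) : ℝ≥0∞ :=
  ∑ u : Level m l, expect P fun ω => Y W μ u.toList ω ^ q

end Random

end Cascade

/-! The bound is proved by induction on the height `h` of the tree, for tuples below an arbitrary
vertex `v` and over an arbitrary finite index type. With `c l` the number of vertices of level `l`
in the spanned tree, put `θ l = (c (l+1) - c l + [l = l₀] e) / (q - 1)`. The claim,
`IsCascade.sum_patternMoment_le`, bounds the sum over all tuples of a given shape by `κ v ^ (1 - ∑ θ
l)` times the product of the level moments below `v` to the powers `θ l`. The counts telescope, so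
`∑ θ l ≤ 1` as soon as the number of indices plus `e` is at most `q`. At the root `κ = 1`, and the
first factor disappears.

In the inductive step the indices split into blocks by first letter. Distinct blocks sit below
distinct children, so independence factors the expectation. The `e`-th power goes to the block
containing the mark; if the mark is `v` itself, the power is independent of the blocks and Jensen
bounds it by `κ v ^ e`. Once the blocks may share children, the sum of products becomes a product
over blocks of sums over children. In such a sum the child's weight occurs with exponent `t`, the
block size plus its share of `e`. Log-convexity gives `E w^t ≤ (E w^q)^((t-1)/(q-1))`, and
`(t-1)/(q-1)` is exactly the sum of the block's `θ`, so Hölder over the children turns child moments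
into moments below `v`.

It remains to see that an automorphism orbit lies inside a shape class, with marks determined by
leaves, and that `c (l+1) - c l` is the number of join points of level `l` with multiplicity. -/

namespace Cascade

/-- The words of which `v` is an initial segment. -/
def fullCone {m : ℕ} (v : Word m) : Set (Word m) := {u | v <+: u}

/-- The words of which `v` is a proper initial segment. -/
def openCone {m : ℕ} (v : Word m) : Set (Word m) := {u | v <+: u ∧ v.length < u.length}

/-- The σ-algebra generated by the weights `w u`, `u ∈ S`. -/
@[reducible]
def weightSigma {m : ℕ} {Ω : Type*} (w : Word m → Ω → ℝ≥0∞) (S : Set (Word m)) :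
    MeasurableSpace Ω :=
  ⨆ v ∈ S, MeasurableSpace.comap (w v) inferInstance

/-- Multiplicative cascade weights `w` of mean one together with an additive mass `κ` on words. -/
structure IsCascade {m : ℕ} {Ω : Type*} [MeasurableSpace Ω] (P : Measure Ω)
    (w : Word m → Ω → ℝ≥0∞) (κ : Word m → ℝ≥0∞) : Prop where
  meas : ∀ v, Measurable (w v)
  indep : iIndepFun w P
  mean : ∀ v, ∫⁻ ω, w v ω ∂P = 1
  additive : ∀ v, ∑ c : Fin m, κ (v ++ [c]) = κ v

/-- The mass of `v ++ u` after multiplication by the weights strictly between `v` and `v ++ u`,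
those at `v ++ u` included. -/
noncomputable def relMass {m : ℕ} {Ω : Type*} (w : Word m → Ω → ℝ≥0∞) (κ : Word m → ℝ≥0∞) :
    Word m → Word m → Ω → ℝ≥0∞
  | v, [], _ => κ v
  | v, a :: u, ω => w (v ++ [a]) ω * relMass w κ (v ++ [a]) u ω

/-! ### Cones and first letters of words -/

section Words

variable {m : ℕ}

theorem fullCone_disjoint {v : Word m} {a b : Fin m} (h : a ≠ b) :
    Disjoint (fullCone (v ++ [a])) (fullCone (v ++ [b])) := by
  rw [Set.disjoint_left]
  intro u ha hb
  have := List.prefix_of_prefix_length_le ha hb (by simp)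
  have := this.eq_of_length (by simp)
  simp at this
  exact h this

theorem fullCone_subset_openCone (v : Word m) (a : Fin m) :
    fullCone (v ++ [a]) ⊆ openCone v := by
  intro u hu
  refine ⟨(List.prefix_append v [a]).trans hu, ?_⟩
  have := List.IsPrefix.length_le hu
  simp at this
  omega

theorem openCone_subset_fullCone (v : Word m) : openCone v ⊆ fullCone v := fun _ h => h.1

/-- Splitting a nonempty word into its first letter and the rest. -/
def levelSuccEquiv (m h : ℕ) : Fin m × Level m h ≃ Level m (h + 1) where
  toFun x := x.1 ::ᵥ x.2
  invFun u := (u.head, u.tail)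
  left_inv x := by simp
  right_inv u := by simp

theorem sum_level_succ {M : Type*} [AddCommMonoid M] {h : ℕ} (f : Level m (h + 1) → M) :
    ∑ u, f u = ∑ a, ∑ u : Level m h, f (a ::ᵥ u) := by
  rw [← (levelSuccEquiv m h).sum_comp, Fintype.sum_prod_type]
  rfl

end Words

/-! ### Measurability for an explicitly named σ-algebra -/

section Measurability

variable {Ω : Type*} (M : MeasurableSpace Ω) {f g : Ω → ℝ≥0∞}

theorem measurable_mul_of (hf : Measurable[M] f) (hg : Measurable[M] g) :
    Measurable[M] fun ω => f ω * g ω := hf.mul hg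

theorem measurable_rpow_of (hf : Measurable[M] f) (q : ℝ) :
    Measurable[M] fun ω => f ω ^ q := hf.pow_const q

theorem measurable_sum_of {ι : Type*} (s : Finset ι) {f : ι → Ω → ℝ≥0∞}
    (hf : ∀ i ∈ s, Measurable[M] (f i)) : Measurable[M] fun ω => ∑ i ∈ s, f i ω :=
  Finset.measurable_fun_sum s hf

theorem measurable_prod_of {ι : Type*} (s : Finset ι) {f : ι → Ω → ℝ≥0∞}
    (hf : ∀ i ∈ s, Measurable[M] (f i)) : Measurable[M] fun ω => ∏ i ∈ s, f i ω :=
  Finset.measurable_fun_prod s hf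

end Measurability

/-! ### Independence, moments and Hölder inequalities -/

section Weights

variable {m : ℕ} {Ω : Type*} {w : Word m → Ω → ℝ≥0∞} {κ : Word m → ℝ≥0∞}

theorem weightSigma_mono {S T : Set (Word m)} (h : S ⊆ T) : weightSigma w S ≤ weightSigma w T :=
  biSup_mono h

theorem measurable_weight {S : Set (Word m)} {v : Word m} (h : v ∈ S) :
    Measurable[weightSigma w S] (w v) :=
  (comap_measurable (w v)).mono (le_biSup (fun v => MeasurableSpace.comap (w v) inferInstance) h)
    le_rfl

theorem measurable_relMass_openCone (v u : Word m) :
    Measurable[weightSigma w (openCone v)] (relMass w κ v u) := by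
  induction u generalizing v with
  | nil => exact @measurable_const _ _ _ (weightSigma w (openCone v)) _
  | cons a u ih =>
    refine measurable_mul_of (weightSigma w (openCone v)) ?_ ?_
    · exact measurable_weight (fullCone_subset_openCone v a (List.prefix_refl _))
    · exact (ih (v ++ [a])).mono (weightSigma_mono
        ((openCone_subset_fullCone _).trans (fullCone_subset_openCone v a))) le_rfl

variable [MeasurableSpace Ω] {P : Measure Ω}

theorem IsCascade.weightSigma_le (hw : IsCascade P w κ) (S : Set (Word m)) :
    weightSigma w S ≤ ‹MeasurableSpace Ω› :=
  iSup₂_le fun v _ => (hw.meas v).comap_le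

/-- Weights over disjoint sets of vertices generate independent σ-algebras; with values in `[0, ∞]`
no integrability is needed. -/
theorem IsCascade.lintegral_mul (hw : IsCascade P w κ) {S T : Set (Word m)} (hST : Disjoint S T)
    {f g : Ω → ℝ≥0∞} (hf : Measurable[weightSigma w S] f) (hg : Measurable[weightSigma w T] g) :
    ∫⁻ ω, f ω * g ω ∂P = (∫⁻ ω, f ω ∂P) * ∫⁻ ω, g ω ∂P :=
  lintegral_mul_eq_lintegral_mul_lintegral_of_independent_measurableSpace
    (hw.weightSigma_le S) (hw.weightSigma_le T)
    (indep_iSup_of_disjoint (fun v => (hw.meas v).comap_le) hw.indep hST) hf hg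

theorem IsCascade.lintegral_prod [IsProbabilityMeasure P] (hw : IsCascade P w κ) {β : Type*}
    (s : Finset β) {S : β → Set (Word m)} (hS : Pairwise fun a b => Disjoint (S a) (S b))
    {G : β → Ω → ℝ≥0∞} (hG : ∀ b, Measurable[weightSigma w (S b)] (G b)) :
    ∫⁻ ω, ∏ b ∈ s, G b ω ∂P = ∏ b ∈ s, ∫⁻ ω, G b ω ∂P := by
  classical
  induction s using Finset.induction with
  | empty => simp
  | insert b s hb ih =>
    simp only [Finset.prod_insert hb]
    rw [hw.lintegral_mul (S := S b) (T := ⋃ c ∈ s, S c) _ (hG b), ih]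
    · refine measurable_prod_of _ s fun c hc => ?_
      exact (hG c).mono (weightSigma_mono (Set.subset_biUnion_of_mem (u := S) hc)) le_rfl
    · simp only [Set.disjoint_iUnion_right]
      exact fun c hc => hS (fun h => hb (h ▸ hc))

theorem IsCascade.measurable_relMass (hw : IsCascade P w κ) (v u : Word m) :
    Measurable (relMass w κ v u) :=
  (measurable_relMass_openCone v u).mono (hw.weightSigma_le _) le_rfl

theorem disjoint_singleton_openCone (v : Word m) : Disjoint {v} (openCone v) :=
  Set.disjoint_singleton_left.2 fun h => lt_irrefl _ h.2

/-- The sum over the descendants `u` of `v` that lie `l` levels below of the `q`-th moments. -/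
noncomputable def relMoment (P : Measure Ω) (w : Word m → Ω → ℝ≥0∞) (κ : Word m → ℝ≥0∞) (q : ℝ)
    (v : Word m) (l : ℕ) : ℝ≥0∞ :=
  ∑ u : Level m l, ∫⁻ ω, relMass w κ v u.toList ω ^ q ∂P

theorem relMoment_zero [IsProbabilityMeasure P] (q : ℝ) (v : Word m) :
    relMoment P w κ q v 0 = κ v ^ q := by
  simp [relMoment, relMass]

/-- The weight at a child is independent of all weights strictly below it. -/
theorem IsCascade.relMoment_succ (hw : IsCascade P w κ) {q : ℝ} (hq : 0 ≤ q)
    (v : Word m) (l : ℕ) :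
    relMoment P w κ q v (l + 1) =
      ∑ c, (∫⁻ ω, w (v ++ [c]) ω ^ q ∂P) * relMoment P w κ q (v ++ [c]) l := by
  rw [relMoment, sum_level_succ]
  refine Finset.sum_congr rfl fun c _ => ?_
  rw [relMoment, Finset.mul_sum]
  refine Finset.sum_congr rfl fun u _ => ?_
  rw [List.Vector.toList_cons, ← hw.lintegral_mul (disjoint_singleton_openCone (v ++ [c]))
    (measurable_rpow_of _ (measurable_weight (Set.mem_singleton _)) q)
    (measurable_rpow_of _ (measurable_relMass_openCone _ _) q)]
  refine lintegral_congr fun ω => ?_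
  rw [relMass, ENNReal.mul_rpow_of_nonneg _ _ hq]

/-- Conservation of mean mass: the first-moment case of `IsCascade.relMoment_succ`, with weights of
mean one and `κ` additive. -/
theorem IsCascade.sum_lintegral_relMass [IsProbabilityMeasure P] (hw : IsCascade P w κ) (h : ℕ)
    (v : Word m) : ∑ u : Level m h, ∫⁻ ω, relMass w κ v u.toList ω ∂P = κ v := by
  have key : ∀ v, relMoment P w κ 1 v h = κ v := by
    induction h with
    | zero => intro v; simp [relMoment_zero]
    | succ h ih =>
      intro v
      rw [hw.relMoment_succ zero_le_one, ← hw.additive v]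
      simp [ih, hw.mean]
  simpa [relMoment] using key v

/-- Jensen for a concave power, obtained from Hölder against the constant `1`. -/
theorem lintegral_rpow_le_rpow_lintegral [IsProbabilityMeasure P] {f : Ω → ℝ≥0∞}
    (hf : Measurable f) {e : ℝ} (he₀ : 0 ≤ e) (he₁ : e ≤ 1) :
    ∫⁻ ω, f ω ^ e ∂P ≤ (∫⁻ ω, f ω ∂P) ^ e := by
  simpa using ENNReal.lintegral_mul_norm_pow_le (μ := P) hf.aemeasurable
    (g := fun _ => 1) aemeasurable_const he₀ (sub_nonneg.2 he₁) (by ring)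

/-- Moments of a variable of mean one are log-convex. -/
theorem lintegral_rpow_le_of_mean_one [IsProbabilityMeasure P] {f : Ω → ℝ≥0∞}
    (hf : Measurable f) (hmean : ∫⁻ ω, f ω ∂P = 1) {t q : ℝ} (hq : 1 < q) (ht₁ : 1 ≤ t)
    (htq : t ≤ q) :
    ∫⁻ ω, f ω ^ t ∂P ≤ (∫⁻ ω, f ω ^ q ∂P) ^ ((t - 1) / (q - 1)) := by
  have hq' : 0 < q - 1 := by linarith
  have h0 : 0 ≤ (t - 1) / (q - 1) := div_nonneg (by linarith) hq'.le
  have h1 : (t - 1) / (q - 1) ≤ 1 := (div_le_one hq').2 (by linarith)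
  -- With `s = (t - 1) / (q - 1)` one has `t = q s + (1 - s)`, so `f ^ t = (f ^ q) ^ s * f ^ (1 -
  -- s)`; the second factor contributes `(E f) ^ (1 - s) = 1`.
  have := ENNReal.lintegral_mul_norm_pow_le (μ := P) (hf.pow_const q).aemeasurable
    hf.aemeasurable h0 (sub_nonneg.2 h1) (by ring)
  rw [hmean, ENNReal.one_rpow, mul_one] at this
  refine le_trans (le_of_eq ?_) this
  refine lintegral_congr fun ω => ?_
  rw [← ENNReal.rpow_mul, ← ENNReal.rpow_add_of_nonneg _ _ (by positivity) (sub_nonneg.2 h1)]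
  congr 1
  field_simp
  ring

/-- Hölder for counting measure, with the unused exponent placed on `g`. In the application `g` is
the mass of a child, whose sum is known by additivity. -/
theorem sum_mul_prod_rpow_le {α ι : Type*} [Fintype α] (s : Finset ι) (g : α → ℝ≥0∞)
    (f : ι → α → ℝ≥0∞) (p : ι → ℝ) (hp : ∀ i ∈ s, 0 ≤ p i) (hs : ∑ i ∈ s, p i ≤ 1) :
    ∑ a, g a ^ (1 - ∑ i ∈ s, p i) * ∏ i ∈ s, f i a ^ p i ≤
      (∑ a, g a) ^ (1 - ∑ i ∈ s, p i) * ∏ i ∈ s, (∑ a, f i a) ^ p i := by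
  let _ : MeasurableSpace α := ⊤
  have := ENNReal.lintegral_mul_prod_norm_pow_le (μ := Measure.count (α := α)) s (g := g) (f := f)
    (measurable_from_top).aemeasurable (fun i _ => (measurable_from_top).aemeasurable)
    (1 - ∑ i ∈ s, p i) (p := p) (by ring) (by linarith) hp
  simpa [lintegral_fintype] using this

end Weights

/-! ### Shapes of tuples and vertex counts of spanned trees -/

section Shapes

variable {m h : ℕ} {ι : Type}

/-- A word without its first letter. -/
def Level.rest (u : Level m (h + 1)) : Level m h := u.tail

theorem Level.cons_head_rest (u : Level m (h + 1)) : u.head ::ᵥ u.rest = u :=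
  List.Vector.cons_head_tail u

theorem Level.toList_eq_cons (u : Level m (h + 1)) : u.toList = u.head :: u.rest.toList := by
  rw [← List.Vector.toList_cons, Level.cons_head_rest]

/-- Two tuples have the same shape if the same pairs of their words agree up to each level. -/
def SameShape (J K : ι → Level m h) : Prop :=
  ∀ l r s, (J r).toList.take l = (J s).toList.take l ↔ (K r).toList.take l = (K s).toList.take l

open Classical in
/-- The words that leave the tree spanned by `K` at the vertex of level `l₀` below `K r₀`. -/
noncomputable def offMark (K : ι → Level m h) (r₀ : ι) (l₀ : ℕ) : Finset (Level m h) :=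
  {j | j.toList.take l₀ = (K r₀).toList.take l₀ ∧
    (l₀ < h → ∀ r, j.toList.take (l₀ + 1) ≠ (K r).toList.take (l₀ + 1))}

/-- The label of `r` at level `l`: its prefix of length `l`, with `r` itself added once `l > h`. -/
def levelKey (J : ι → Level m h) (l : ℕ) (r : ι) : Word m × Option ι :=
  ((J r).toList.take l, if l ≤ h then none else some r)

open Classical in
/-- The number of vertices of level `l` of the tree spanned by `J`, where the indices count as
vertices of level `h + 1`. -/
noncomputable def classCount [Fintype ι] (J : ι → Level m h) (l : ℕ) : ℕ :=
  (Finset.univ.image (levelKey J l)).card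

theorem classCount_zero [Fintype ι] [Nonempty ι] (J : ι → Level m h) : classCount J 0 = 1 := by
  have : levelKey J 0 = fun _ => ([], none) := by
    funext r
    simp [levelKey]
  simp [classCount, this, Finset.image_const]

theorem classCount_last [Fintype ι] (J : ι → Level m h) :
    classCount J (h + 1) = Fintype.card ι := by
  classical
  rw [classCount, Finset.card_image_of_injective, Finset.card_univ]
  intro r s hrs
  simpa [levelKey] using congrArg Prod.snd hrs

theorem levelKey_eq_of_succ {J : ι → Level m h} {l : ℕ} {r s : ι}
    (hrs : levelKey J (l + 1) r = levelKey J (l + 1) s) : levelKey J l r = levelKey J l s := by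
  simp only [levelKey, Prod.mk.injEq] at hrs ⊢
  constructor
  · have := congrArg (List.take l) hrs.1
    simpa [List.take_take] using this
  · by_cases hl : l ≤ h
    · simp [hl]
    · have hl' : ¬ l + 1 ≤ h := by omega
      simpa [hl, hl'] using hrs.2

/-- Labels of level `l + 1` determine, and surject onto, those of level `l`. -/
theorem classCount_le_succ [Fintype ι] (J : ι → Level m h) (l : ℕ) :
    classCount J l ≤ classCount J (l + 1) := by
  classical
  refine Finset.card_le_card_of_surjOn
    (fun x => if hx : ∃ r, levelKey J (l + 1) r = x then levelKey J l hx.choose else x) ?_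
  intro x hx
  simp only [Finset.coe_image, Finset.coe_univ, Set.image_univ, Set.mem_range] at hx
  obtain ⟨r, rfl⟩ := hx
  refine ⟨levelKey J (l + 1) r, by simp, ?_⟩
  have hx : ∃ s, levelKey J (l + 1) s = levelKey J (l + 1) r := ⟨r, rfl⟩
  simp only [dif_pos hx]
  exact levelKey_eq_of_succ hx.choose_spec

/-- The exponent with which the moment of level `l` enters the bound. -/
noncomputable def joinExponent [Fintype ι] (J : ι → Level m h) (l₀ : ℕ) (e q : ℝ) (l : ℕ) : ℝ :=
  ((classCount J (l + 1) : ℝ) - classCount J l + if l = l₀ then e else 0) / (q - 1)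

theorem joinExponent_nonneg [Fintype ι] (J : ι → Level m h) (l₀ : ℕ) {e q : ℝ} (he : 0 ≤ e)
    (hq : 1 < q) (l : ℕ) : 0 ≤ joinExponent J l₀ e q l := by
  have := classCount_le_succ J l
  refine div_nonneg (add_nonneg (sub_nonneg.2 (by exact_mod_cast this)) ?_) (by linarith)
  split_ifs
  exacts [he, le_rfl]

/-- The counts telescope from `1` at the root to `card ι` at level `h + 1`, and the mark adds `e`
once. -/
theorem sum_joinExponent [Fintype ι] [Nonempty ι] (J : ι → Level m h) {l₀ : ℕ} (hl₀ : l₀ ≤ h)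
    (e q : ℝ) : ∑ l ∈ Finset.range (h + 1), joinExponent J l₀ e q l =
      (Fintype.card ι - 1 + e) / (q - 1) := by
  simp only [joinExponent]
  rw [← Finset.sum_div, Finset.sum_add_distrib,
    Finset.sum_range_sub (fun l => (classCount J l : ℝ)), classCount_last, classCount_zero,
    Finset.sum_ite_eq', if_pos (Finset.mem_range.2 (by omega))]
  simp

/-- Removing the root leaves the disjoint union of the trees spanned by the blocks, each one level
higher up. -/
theorem classCount_succ [Fintype ι] {β : Type} [Fintype β] [DecidableEq β]
    (J : ι → Level m (h + 1)) (a : ι → β) (g : β ↪ Fin m) (hg : ∀ r, (J r).head = g (a r)) (l : ℕ) :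
    classCount J (l + 1) = ∑ b, classCount (fun r => (J r).rest : {r // a r = b} → Level m h) l := by
  classical
  simp only [classCount]
  rw [← Finset.card_sigma]
  -- Restores the first letter of the block, which makes labels from different blocks distinct.
  let G : (Σ b : β, Word m × Option {r // a r = b}) → Word m × Option ι :=
    fun x => (g x.1 :: x.2.1, x.2.2.map Subtype.val)
  have hG : Function.Injective G := by
    rintro ⟨b, u, o⟩ ⟨b', u', o'⟩ hx
    simp only [G, Prod.mk.injEq, List.cons.injEq, EmbeddingLike.apply_eq_iff_eq] at hx
    obtain ⟨⟨rfl, rfl⟩, ho⟩ := hx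
    rw [Option.map_injective Subtype.val_injective ho]
  rw [← Finset.card_image_of_injective _ hG]
  have key : ∀ r, levelKey J (l + 1) r =
      G ⟨a r, levelKey (fun r' => (J r').rest : {r' // a r' = a r} → Level m h) l ⟨r, rfl⟩⟩ := by
    intro r
    have : (J r).toList = g (a r) :: (J r).rest.toList := by
      rw [← hg, Level.toList_eq_cons]
    simp only [levelKey, G, this, List.take_succ_cons, Nat.add_le_add_iff_right]
    split_ifs <;> rfl
  congr 1
  ext x
  simp only [Finset.mem_image, Finset.mem_univ, true_and, Finset.mem_sigma]
  constructor
  · rintro ⟨r, rfl⟩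
    exact ⟨_, ⟨⟨r, rfl⟩, rfl⟩, (key r).symm⟩
  · rintro ⟨⟨b, y⟩, ⟨⟨r, hr⟩, hy⟩, rfl⟩
    dsimp only at hr hy
    subst hr
    exact ⟨r, by rw [key, ← hy]⟩

/-- The tuple with first letters `f (a r)` and tails `K' (a r) r`. -/
def assemble {β : Type} (a : ι → β) (f : β → Fin m) (K' : ∀ b, {r // a r = b} → Level m h) :
    ι → Level m (h + 1) :=
  fun r => f (a r) ::ᵥ K' (a r) ⟨r, rfl⟩

theorem assemble_apply {β : Type} (a : ι → β) (f : β → Fin m)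
    (K' : ∀ b, {r // a r = b} → Level m h) {b : β} (r : {r // a r = b}) :
    assemble a f K' r = f b ::ᵥ K' b r := by
  obtain ⟨r, rfl⟩ := r
  rfl

theorem prod_relMass_assemble [Fintype ι] {β : Type} [Fintype β] [DecidableEq β] {Ω : Type*}
    {w : Word m → Ω → ℝ≥0∞} {κ : Word m → ℝ≥0∞} (v : Word m) (a : ι → β) (f : β → Fin m)
    (K' : ∀ b, {r // a r = b} → Level m h) (ω : Ω) :
    ∏ r, relMass w κ v (assemble a f K' r).toList ω =
      ∏ b, ∏ r, relMass w κ v (f b :: (K' b r).toList) ω := by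
  rw [← Fintype.prod_fiberwise a]
  refine Finset.prod_congr rfl fun b _ => Finset.prod_congr rfl ?_
  rintro ⟨r, rfl⟩ _
  simp [assemble]

end Shapes

/-! ### Factoring the expectation over the children of a vertex -/

section Moments

variable {m h : ℕ} {ι : Type} [Fintype ι] {Ω : Type*} [MeasurableSpace Ω] {P : Measure Ω}
  {w : Word m → Ω → ℝ≥0∞} {κ : Word m → ℝ≥0∞}

/-- The expectation attached to a marked tuple of descendants of `v`. -/
noncomputable def patternMoment (P : Measure Ω) (w : Word m → Ω → ℝ≥0∞) (κ : Word m → ℝ≥0∞)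
    (e : ℝ) (v : Word m) (K : ι → Level m h) (r₀ : ι) (l₀ : ℕ) : ℝ≥0∞ :=
  ∫⁻ ω, (∏ r, relMass w κ v (K r).toList ω) *
    (∑ j ∈ offMark K r₀ l₀, relMass w κ v j.toList ω) ^ e ∂P

variable {β : Type} [Fintype β] [DecidableEq β] [IsProbabilityMeasure P]

/-- Independence of the parts of a tuple below different children of `v`. -/
theorem IsCascade.lintegral_blocks (hw : IsCascade P w κ) (v : Word m) (a : ι → β)
    (f : β ↪ Fin m) (K' : ∀ b, {r // a r = b} → Level m h) (ρ : ∀ b, {r // a r = b}) (l : ℕ)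
    {η : β → ℝ} (hη : ∀ b, 0 ≤ η b) {R : Ω → ℝ≥0∞}
    (hR : Measurable[weightSigma w (⋃ c ∈ (Set.range f)ᶜ, fullCone (v ++ [c]))] R) :
    ∫⁻ ω, R ω * ∏ b, ((∏ r, relMass w κ v (f b :: (K' b r).toList) ω) *
        (w (v ++ [f b]) ω *
          ∑ j ∈ offMark (K' b) (ρ b) l, relMass w κ (v ++ [f b]) j.toList ω) ^ η b) ∂P =
      (∫⁻ ω, R ω ∂P) * ∏ b, ((∫⁻ ω, w (v ++ [f b]) ω ^ ((Fintype.card {r // a r = b} : ℝ) + η b) ∂P) *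
        patternMoment P w κ (η b) (v ++ [f b]) (K' b) (ρ b) l) := by
  -- The weight at the child is common to every word of the block and to its marked sum, so it comes
  -- out with exponent block size plus `η b`.
  have hterm : ∀ b ω, (∏ r, relMass w κ v (f b :: (K' b r).toList) ω) *
        (w (v ++ [f b]) ω *
          ∑ j ∈ offMark (K' b) (ρ b) l, relMass w κ (v ++ [f b]) j.toList ω) ^ η b =
      w (v ++ [f b]) ω ^ ((Fintype.card {r // a r = b} : ℝ) + η b) *
        ((∏ r, relMass w κ (v ++ [f b]) (K' b r).toList ω) *
          (∑ j ∈ offMark (K' b) (ρ b) l, relMass w κ (v ++ [f b]) j.toList ω) ^ η b) := by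
    intro b ω
    simp only [relMass]
    rw [Finset.prod_mul_distrib, Finset.prod_const, Finset.card_univ,
      ENNReal.mul_rpow_of_nonneg _ _ (hη b),
      ENNReal.rpow_add_of_nonneg _ _ (Nat.cast_nonneg _) (hη b), ENNReal.rpow_natCast]
    ring
  have hmw : ∀ b, Measurable[weightSigma w {v ++ [f b]}]
      fun ω => w (v ++ [f b]) ω ^ ((Fintype.card {r // a r = b} : ℝ) + η b) := fun b =>
    measurable_rpow_of _ (measurable_weight (Set.mem_singleton _)) _
  have hmt : ∀ b, Measurable[weightSigma w (openCone (v ++ [f b]))]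
      fun ω => (∏ r, relMass w κ (v ++ [f b]) (K' b r).toList ω) *
          (∑ j ∈ offMark (K' b) (ρ b) l, relMass w κ (v ++ [f b]) j.toList ω) ^ η b := fun b =>
    measurable_mul_of _ (measurable_prod_of _ _ fun r _ => measurable_relMass_openCone _ _)
      (measurable_rpow_of _ (measurable_sum_of _ _ fun r _ => measurable_relMass_openCone _ _) _)
  have hmb : ∀ b, Measurable[weightSigma w (fullCone (v ++ [f b]))]
      fun ω => w (v ++ [f b]) ω ^ ((Fintype.card {r // a r = b} : ℝ) + η b) *
        ((∏ r, relMass w κ (v ++ [f b]) (K' b r).toList ω) *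
          (∑ j ∈ offMark (K' b) (ρ b) l, relMass w κ (v ++ [f b]) j.toList ω) ^ η b) := fun b =>
    measurable_mul_of _
      ((hmw b).mono (weightSigma_mono (Set.singleton_subset_iff.2 (List.prefix_refl _))) le_rfl)
      ((hmt b).mono (weightSigma_mono (openCone_subset_fullCone _)) le_rfl)
  simp only [hterm]
  rw [hw.lintegral_mul (T := ⋃ b, fullCone (v ++ [f b])) _ hR, hw.lintegral_prod _ _ hmb]
  · congr 1
    exact Finset.prod_congr rfl fun b _ =>
      hw.lintegral_mul (disjoint_singleton_openCone _) (hmw b) (hmt b)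
  · exact fun b b' hb => fullCone_disjoint fun h => hb (f.injective h)
  · exact measurable_prod_of _ _ fun b _ => (hmb b).mono
      (weightSigma_mono (Set.subset_iUnion (fun b => fullCone (v ++ [f b])) b)) le_rfl
  · simp only [Set.disjoint_iUnion_left, Set.disjoint_iUnion_right]
    intro b c hc
    exact fullCone_disjoint fun h => hc ⟨b, h.symm⟩

/-- Words leaving the tree at `v` start with a letter used by no block, so their sum is independent
of the blocks; Jensen and conservation of mean mass bound its `e`-th moment by `κ v ^ e`. -/
theorem IsCascade.patternMoment_assemble_zero_le (hw : IsCascade P w κ) {e : ℝ} (he₀ : 0 ≤ e)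
    (he₁ : e ≤ 1) (v : Word m) (a : ι → β) (f : β ↪ Fin m)
    (K' : ∀ b, {r // a r = b} → Level m h) (r₀ : ι) (ρ : ∀ b, {r // a r = b}) :
    patternMoment P w κ e v (assemble a f K') r₀ 0 ≤
      κ v ^ e * ∏ b, ((∫⁻ ω, w (v ++ [f b]) ω ^ ((Fintype.card {r // a r = b} : ℝ) + 0) ∂P) *
        patternMoment P w κ 0 (v ++ [f b]) (K' b) (ρ b) 0) := by
  classical
  let R : Ω → ℝ≥0∞ := fun ω => ∑ c ∈ Finset.univ.filter (· ∉ Set.range f),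
    ∑ j : Level m h, relMass w κ v (c ::ᵥ j).toList ω
  have hR : Measurable[weightSigma w (⋃ c ∈ (Set.range f)ᶜ, fullCone (v ++ [c]))] R := by
    refine measurable_sum_of _ _ fun c hc => measurable_sum_of _ _ fun j _ => ?_
    have hc' : c ∈ (Set.range f)ᶜ := (Finset.mem_filter.1 hc).2
    have hsub := Set.subset_biUnion_of_mem (u := fun c => fullCone (v ++ [c])) hc'
    refine measurable_mul_of _ (measurable_weight (hsub (List.prefix_refl _))) ?_
    exact (measurable_relMass_openCone _ _).mono
      (weightSigma_mono ((openCone_subset_fullCone _).trans hsub)) le_rfl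
  have hR' : Measurable R := hR.mono (hw.weightSigma_le _) le_rfl
  have hRint : ∫⁻ ω, R ω ∂P ≤ κ v := by
    rw [← hw.sum_lintegral_relMass (h + 1) v, sum_level_succ,
      lintegral_finsetSum _ fun c _ => Finset.measurable_fun_sum _ fun j _ =>
        hw.measurable_relMass _ _]
    refine (Finset.sum_le_sum fun c _ => ?_).trans
      (Finset.sum_le_sum_of_subset (Finset.filter_subset _ _))
    rw [lintegral_finsetSum _ fun j _ => hw.measurable_relMass _ _]
  have hsum : ∀ ω, ∑ j ∈ offMark (assemble a f K') r₀ 0, relMass w κ v j.toList ω ≤ R ω := by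
    intro ω
    simp only [R]
    rw [Finset.sum_filter, offMark, Finset.sum_filter, sum_level_succ]
    refine Finset.sum_le_sum fun c _ => ?_
    by_cases hc : c ∈ Set.range f
    · rw [if_neg (not_not.2 hc)]
      refine (Finset.sum_eq_zero fun j _ => if_neg ?_).le
      obtain ⟨b, rfl⟩ := hc
      rintro ⟨-, hj⟩
      -- Blocks are nonempty, so each letter `f b` really begins a word of the tuple.
      refine hj (Nat.succ_pos h) (ρ b) ?_
      simp [assemble, (ρ b).2]
    · rw [if_pos hc]
      refine Finset.sum_le_sum fun j _ => ?_
      split_ifs <;> simp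
  have := hw.lintegral_blocks v a f K' ρ 0 (η := fun _ => 0) (fun _ => le_rfl)
    (measurable_rpow_of _ hR e)
  refine le_trans ?_ (this.le.trans ?_)
  · refine lintegral_mono fun ω => ?_
    simp only [ENNReal.rpow_zero, mul_one]
    rw [prod_relMass_assemble, mul_comm]
    exact mul_le_mul_left (ENNReal.rpow_le_rpow (hsum ω) he₀) _
  · refine mul_le_mul_left ?_ _
    exact (lintegral_rpow_le_rpow_lintegral hR' he₀ he₁).trans (ENNReal.rpow_le_rpow hRint he₀)

/-- Words leaving the tree at a mark strictly below `v` begin with the letter of the mark's block,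
and their tails leave that block's tree one level higher up. The whole exponent `e` goes to this
block. -/
theorem IsCascade.patternMoment_assemble_succ_le (hw : IsCascade P w κ) {e : ℝ} (he₀ : 0 ≤ e)
    (v : Word m) (a : ι → β) (f : β ↪ Fin m)
    (K' : ∀ b, {r // a r = b} → Level m h) (r₀ : ι) (l : ℕ) (ρ : ∀ b, {r // a r = b})
    (hρ : ρ (a r₀) = ⟨r₀, rfl⟩) :
    patternMoment P w κ e v (assemble a f K') r₀ (l + 1) ≤
      ∏ b, ((∫⁻ ω, w (v ++ [f b]) ω ^ ((Fintype.card {r // a r = b} : ℝ) +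
          if b = a r₀ then e else 0) ∂P) *
        patternMoment P w κ (if b = a r₀ then e else 0) (v ++ [f b]) (K' b) (ρ b) l) := by
  classical
  have := hw.lintegral_blocks v a f K' ρ l (η := fun b => if b = a r₀ then e else 0)
    (fun b => by split_ifs; exacts [he₀, le_rfl]) (R := fun _ => 1)
    (@measurable_const _ _ _ (weightSigma w _) _)
  rw [lintegral_one, measure_univ, one_mul] at this
  refine le_trans ?_ this.le
  refine lintegral_mono fun ω => ?_
  dsimp only
  rw [one_mul, prod_relMass_assemble, Finset.prod_mul_distrib]
  refine mul_le_mul_right ?_ _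
  have hpow : ∀ F : β → ℝ≥0∞, ∏ b, F b ^ (if b = a r₀ then e else 0) = F (a r₀) ^ e := by
    intro F
    rw [Finset.prod_eq_single (a r₀)]
    · simp
    · intro b _ hb
      simp [hb]
    · simp
  rw [hpow]
  refine ENNReal.rpow_le_rpow ?_ he₀
  rw [hρ, offMark, offMark, Finset.sum_filter, Finset.sum_filter, sum_level_succ, Finset.mul_sum,
    Finset.sum_eq_single (f (a r₀))]
  · refine Finset.sum_le_sum fun j _ => ?_
    split_ifs with h1 h2
    · simp [relMass]
    · refine absurd ⟨?_, ?_⟩ h2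
      · simpa [assemble] using h1.1
      · intro hl r hr
        refine h1.2 (by omega) r ?_
        simp only [assemble_apply, List.Vector.toList_cons, List.take_succ_cons, hr]
    · simp
    · simp
  · intro c _ hc
    refine Finset.sum_eq_zero fun j _ => if_neg ?_
    rintro ⟨h1, -⟩
    simp [assemble] at h1
    exact hc h1.1
  · simp

end Moments

theorem ennreal_rpow_sum {ι : Type*} (x : ℝ≥0∞) {s : Finset ι} {p : ι → ℝ}
    (hp : ∀ i ∈ s, 0 ≤ p i) : x ^ ∑ i ∈ s, p i = ∏ i ∈ s, x ^ p i := by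
  classical
  induction s using Finset.induction with
  | empty => simp
  | insert i s hi ih =>
    have hs : ∀ j ∈ s, 0 ≤ p j := fun j hj => hp j (Finset.mem_insert_of_mem hj)
    rw [Finset.sum_insert hi, Finset.prod_insert hi, ENNReal.rpow_add_of_nonneg _ _
      (hp i (Finset.mem_insert_self i s)) (Finset.sum_nonneg hs), ih hs]

/-- Dropping injectivity is what later lets a sum of products factor as a product of sums. -/
theorem sum_embedding_le {α β : Type*} [Fintype α] [Fintype β] [DecidableEq α] [DecidableEq β]
    (F : (α → β) → ℝ≥0∞) : ∑ f : α ↪ β, F f ≤ ∑ f, F f := by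
  refine (Finset.sum_map Finset.univ ⟨fun f : α ↪ β => (f : α → β), DFunLike.coe_injective⟩ F).ge.trans ?_
  exact Finset.sum_le_sum_of_subset (Finset.subset_univ _)

/-! ### Induction on the height -/

section Induction

variable {m h : ℕ} {ι : Type} {Ω : Type*} [MeasurableSpace Ω] {P : Measure Ω}
  [IsProbabilityMeasure P] {w : Word m → Ω → ℝ≥0∞} {κ : Word m → ℝ≥0∞}

open Classical in
/-- A sum over the tuples of the shape of `J` is at most the sum over the placements of its blocks
below distinct children and the tuples of the right shapes inside the blocks. -/
theorem sum_sameShape_le {β : Type} [Fintype ι] [Fintype β] (J : ι → Level m (h + 1)) (a : ι → β)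
    (g : β ↪ Fin m) (hg : ∀ r, (J r).head = g (a r)) (ρ : ∀ b, {r // a r = b})
    (Φ : (ι → Level m (h + 1)) → ℝ≥0∞) :
    ∑ K with SameShape J K, Φ K ≤ ∑ f : β ↪ Fin m, ∑ K' ∈ Fintype.piFinset fun b =>
      Finset.univ.filter (SameShape (fun r : {r // a r = b} => (J r).rest)),
        Φ (assemble a f K') := by
  rw [← Finset.sum_product']
  refine le_trans (Finset.sum_le_sum_of_subset ?_)
    (Finset.sum_image_le_of_nonneg (g := fun x : (β ↪ Fin m) × (∀ b, {r // a r = b} → Level m h) =>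
      assemble a x.1 x.2) (fun _ _ => zero_le))
  intro K hK
  have hK : SameShape J K := by simpa using hK
  -- Agreement at level 1 shows that `K` has the same blocks as `J`, at distinct first letters.
  have hhead : ∀ r s, a r = a s ↔ (K r).head = (K s).head := by
    intro r s
    have := hK 1 r s
    simpa [Level.toList_eq_cons, hg] using this
  simp only [Finset.mem_image, Finset.mem_product, Finset.mem_univ, true_and,
    Fintype.mem_piFinset, Finset.mem_filter]
  refine ⟨(⟨fun b => (K (ρ b)).head, fun b b' hb => ?_⟩, fun b r => (K r).rest), ?_, ?_⟩
  · have := (hhead _ _).2 hb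
    rwa [(ρ b).2, (ρ b').2] at this
  · rintro b l ⟨r, hr⟩ ⟨s, hs⟩
    have := hK (l + 1) r s
    have h1 := (hhead r s).1 (hr.trans hs.symm)
    simpa [Level.toList_eq_cons, hg, hr, hs, h1] using this
  · funext r
    change (K (ρ (a r))).head ::ᵥ (K r).rest = K r
    rw [(hhead (ρ (a r)) r).1 (ρ (a r)).2, Level.cons_head_rest]

/-- Hölder's inequality over the children of `v`. -/
theorem IsCascade.sum_children_le (hw : IsCascade P w κ) {q t : ℝ} (hq : 1 < q) (ht₁ : 1 ≤ t)
    (htq : t ≤ q) (v : Word m) (s : Finset ℕ) (θ : ℕ → ℝ) (hθ : ∀ l ∈ s, 0 ≤ θ l)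
    (hθs : ∑ l ∈ s, θ l = (t - 1) / (q - 1)) :
    ∑ c, (∫⁻ ω, w (v ++ [c]) ω ^ t ∂P) * (κ (v ++ [c]) ^ (1 - ∑ l ∈ s, θ l) *
        ∏ l ∈ s, relMoment P w κ q (v ++ [c]) l ^ θ l) ≤
      κ v ^ (1 - ∑ l ∈ s, θ l) * ∏ l ∈ s, relMoment P w κ q v (l + 1) ^ θ l := by
  have hle : ∑ l ∈ s, θ l ≤ 1 := by
    rw [hθs]
    exact (div_le_one (by linarith)).2 (by linarith)
  refine le_trans (Finset.sum_le_sum fun c _ => ?_) (le_trans (sum_mul_prod_rpow_le s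
    (fun c => κ (v ++ [c])) (fun l c => (∫⁻ ω, w (v ++ [c]) ω ^ q ∂P) *
      relMoment P w κ q (v ++ [c]) l) θ hθ hle) ?_)
  -- By `hθs` the interpolated power of `E w^q` has exponent `∑ θ l`, so it can be shared out, one
  -- power `θ l` to each level moment.
  · have h1 := lintegral_rpow_le_of_mean_one (hw.meas (v ++ [c])) (hw.mean _) hq ht₁ htq
    rw [← hθs] at h1
    refine (mul_le_mul_left h1 _).trans (le_of_eq ?_)
    rw [ennreal_rpow_sum _ hθ, mul_left_comm, ← Finset.prod_mul_distrib]
    congr 1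
    exact Finset.prod_congr rfl fun l hl => (ENNReal.mul_rpow_of_nonneg _ _ (hθ l hl)).symm
  · rw [hw.additive]
    refine le_of_eq ?_
    congr 1
    exact Finset.prod_congr rfl fun l _ => by rw [hw.relMoment_succ (by linarith)]

-- Both positions of the mark in one formula. When `l₀ = 0` the truncated `l₀ - 1` is harmless,
-- since every block then has exponent `0`.
open Classical in
theorem IsCascade.patternMoment_assemble_le (hw : IsCascade P w κ) [Fintype ι] {β : Type}
    [Fintype β] {e : ℝ} (he₀ : 0 ≤ e)
    (he₁ : e ≤ 1) (v : Word m) (a : ι → β) (f : β ↪ Fin m)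
    (K' : ∀ b, {r // a r = b} → Level m h) (r₀ : ι) (l₀ : ℕ) (ρ : ∀ b, {r // a r = b})
    (hρ : ρ (a r₀) = ⟨r₀, rfl⟩) :
    patternMoment P w κ e v (assemble a f K') r₀ l₀ ≤
      κ v ^ (if l₀ = 0 then e else 0) * ∏ b, ((∫⁻ ω, w (v ++ [f b]) ω ^
          ((Fintype.card {r // a r = b} : ℝ) + if b = a r₀ ∧ l₀ ≠ 0 then e else 0) ∂P) *
        patternMoment P w κ (if b = a r₀ ∧ l₀ ≠ 0 then e else 0) (v ++ [f b]) (K' b) (ρ b)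
          (l₀ - 1)) := by
  cases l₀ with
  | zero => simpa using hw.patternMoment_assemble_zero_le he₀ he₁ v a f K' r₀ ρ
  | succ l => simpa using hw.patternMoment_assemble_succ_le he₀ v a f K' r₀ l ρ hρ

theorem patternMoment_level_zero_le [Fintype ι] {e : ℝ} (he₀ : 0 ≤ e) (v : Word m)
    (K : ι → Level m 0) (r₀ : ι) (l₀ : ℕ) :
    patternMoment P w κ e v K r₀ l₀ ≤ κ v ^ ((Fintype.card ι : ℝ) + e) := by
  have hnil : ∀ u : Level m 0, u.toList = [] := fun u => List.eq_nil_of_length_eq_zero u.2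
  refine (lintegral_mono (g := fun _ => κ v ^ ((Fintype.card ι : ℝ) + e)) fun ω => ?_).trans
    (by simp)
  rw [ENNReal.rpow_add_of_nonneg _ _ (Nat.cast_nonneg _) he₀, ENNReal.rpow_natCast]
  simp only [hnil, relMass, Finset.prod_const, Finset.card_univ, Finset.sum_const]
  gcongr
  have : (offMark K r₀ l₀).card ≤ 1 := Finset.card_le_one_of_subsingleton _
  calc (offMark K r₀ l₀).card • κ v ≤ 1 • κ v := by gcongr
    _ = κ v := one_smul _ _

-- The inductive step: independence across blocks, then Hölder in each block, then a count of
-- exponents.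
open Classical in
theorem IsCascade.sum_patternMoment_succ_le (hw : IsCascade P w κ) [Fintype ι] {β : Type}
    [Fintype β] {q : ℝ} (hq : 1 < q) (J : ι → Level m (h + 1)) (a : ι → β) (g : β ↪ Fin m)
    (hg : ∀ r, (J r).head = g (a r)) (r₀ : ι) (ρ : ∀ b, {r // a r = b})
    (hρ : ρ (a r₀) = ⟨r₀, rfl⟩) {l₀ : ℕ} (hl₀ : l₀ ≤ h + 1) {e : ℝ} (he₀ : 0 ≤ e) (he₁ : e ≤ 1)
    (hle : Fintype.card ι + e ≤ q) (v : Word m)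
    (ih : ∀ (b : β) (η : ℝ) (_ : 0 ≤ η) (_ : η ≤ 1) (_ : Fintype.card {r // a r = b} + η ≤ q)
      (v : Word m),
      ∑ K with SameShape (fun r : {r // a r = b} => (J r).rest) K,
        patternMoment P w κ η v K (ρ b) (l₀ - 1) ≤
      κ v ^ (1 - ∑ l ∈ Finset.range (h + 1),
          joinExponent (fun r : {r // a r = b} => (J r).rest) (l₀ - 1) η q l) *
        ∏ l ∈ Finset.range (h + 1), relMoment P w κ q v l ^
          joinExponent (fun r : {r // a r = b} => (J r).rest) (l₀ - 1) η q l) :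
    ∑ K with SameShape J K, patternMoment P w κ e v K r₀ l₀ ≤
      κ v ^ (1 - ∑ l ∈ Finset.range (h + 1 + 1), joinExponent J l₀ e q l) *
        ∏ l ∈ Finset.range (h + 1 + 1), relMoment P w κ q v l ^ joinExponent J l₀ e q l := by
  have hq' : 0 < q - 1 := by linarith
  have hι : Nonempty ι := ⟨r₀⟩
  have hsurj : ∀ b, Nonempty {r // a r = b} := fun b => ⟨ρ b⟩
  let J' : ∀ b, {r // a r = b} → Level m h := fun b r => (J r).rest
  let η : β → ℝ := fun b => if b = a r₀ ∧ l₀ ≠ 0 then e else 0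
  let e₀ : ℝ := if l₀ = 0 then e else 0
  have he₀' : 0 ≤ e₀ := by
    simp only [e₀]
    split_ifs
    exacts [he₀, le_rfl]
  have hη₀ : ∀ b, 0 ≤ η b := fun b => by
    simp only [η]
    split_ifs
    exacts [he₀, le_rfl]
  have hηe : ∀ b, η b ≤ e := fun b => by
    simp only [η]
    split_ifs
    exacts [le_rfl, he₀]
  let t : β → ℝ := fun b => (Fintype.card {r // a r = b} : ℝ) + η b
  have hcard₁ : ∀ b, (1 : ℝ) ≤ Fintype.card {r // a r = b} := fun b => by
    exact_mod_cast Fintype.card_pos (α := {r // a r = b})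
  have ht₁ : ∀ b, 1 ≤ t b := fun b => by
    have := hcard₁ b
    have := hη₀ b
    simp only [t]
    linarith
  have htq : ∀ b, t b ≤ q := fun b => by
    have h1 : (Fintype.card {r // a r = b} : ℝ) ≤ Fintype.card ι := by
      exact_mod_cast Fintype.card_subtype_le _
    have := hηe b
    simp only [t]
    linarith
  let θ : β → ℕ → ℝ := fun b => joinExponent (J' b) (l₀ - 1) (η b) q
  have hθ₀ : ∀ b l, 0 ≤ θ b l := fun b l => joinExponent_nonneg _ _ (hη₀ b) hq l
  have hθs : ∀ b, ∑ l ∈ Finset.range (h + 1), θ b l = (t b - 1) / (q - 1) := fun b => by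
    rw [sum_joinExponent _ (by omega)]
    congr 1
    simp only [t]
    ring
  let M : β → Fin m → ℝ≥0∞ := fun b c => ∫⁻ ω, w (v ++ [c]) ω ^ t b ∂P
  let S : ∀ b, Finset ({r // a r = b} → Level m h) :=
    fun b => Finset.univ.filter (SameShape (J' b))
  let E : ∀ b, Fin m → ({r // a r = b} → Level m h) → ℝ≥0∞ :=
    fun b c K => patternMoment P w κ (η b) (v ++ [c]) K (ρ b) (l₀ - 1)
  calc ∑ K with SameShape J K, patternMoment P w κ e v K r₀ l₀
      ≤ ∑ f : β ↪ Fin m, ∑ K' ∈ Fintype.piFinset S,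
            patternMoment P w κ e v (assemble a f K') r₀ l₀ :=
        sum_sameShape_le J a g hg ρ _
    _ ≤ ∑ f : β ↪ Fin m, ∑ K' ∈ Fintype.piFinset S,
          κ v ^ e₀ * ∏ b, (M b (f b) * E b (f b) (K' b)) :=
        Finset.sum_le_sum fun f _ => Finset.sum_le_sum fun K' _ =>
          hw.patternMoment_assemble_le he₀ he₁ v a f K' r₀ l₀ ρ hρ
    _ = κ v ^ e₀ * ∑ f : β ↪ Fin m, ∏ b, (M b (f b) * ∑ K ∈ S b, E b (f b) K) := by
        rw [Finset.mul_sum]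
        refine Finset.sum_congr rfl fun f _ => ?_
        simp only [Finset.mul_sum (S _)]
        rw [Finset.prod_univ_sum, Finset.mul_sum]
    _ ≤ κ v ^ e₀ * ∑ f : β → Fin m, ∏ b, (M b (f b) * ∑ K ∈ S b, E b (f b) K) :=
        mul_le_mul_right
          (sum_embedding_le fun f => ∏ b, (M b (f b) * ∑ K ∈ S b, E b (f b) K)) _
    _ = κ v ^ e₀ * ∏ b, ∑ c, (M b c * ∑ K ∈ S b, E b c K) := by
        rw [Fintype.prod_sum]
    _ ≤ κ v ^ e₀ * ∏ b, (κ v ^ (1 - ∑ l ∈ Finset.range (h + 1), θ b l) *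
          ∏ l ∈ Finset.range (h + 1), relMoment P w κ q v (l + 1) ^ θ b l) := by
        refine mul_le_mul_right (Finset.prod_le_prod' fun b _ => ?_) _
        refine le_trans (Finset.sum_le_sum fun c _ => mul_le_mul_right
          (ih b (η b) (hη₀ b) ((hηe b).trans he₁) (htq b) _) _) ?_
        exact hw.sum_children_le hq (ht₁ b) (htq b) v _ (θ b) (fun l _ => hθ₀ b l) (hθs b)
    _ = κ v ^ (1 - ∑ l ∈ Finset.range (h + 1 + 1), joinExponent J l₀ e q l) *
        ∏ l ∈ Finset.range (h + 1 + 1), relMoment P w κ q v l ^ joinExponent J l₀ e q l := by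
        have hΘ := sum_joinExponent J hl₀ e q
        -- Vertex counts add over blocks, and the mark lies in only one of them.
        have hsucc : ∀ l, joinExponent J l₀ e q (l + 1) = ∑ b, θ b l := by
          intro l
          simp only [joinExponent, θ]
          rw [← Finset.sum_div, Finset.sum_add_distrib, Finset.sum_sub_distrib,
            classCount_succ J a g hg, classCount_succ J a g hg]
          push_cast
          congr 2
          simp only [η]
          rcases Nat.eq_zero_or_pos l₀ with rfl | hpos
          · simp
          · by_cases hl : l + 1 = l₀
            · have h1 : l = l₀ - 1 := by omega
              simp [← h1, hl, hpos.ne']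
            · have h1 : l ≠ l₀ - 1 := by omega
              simp [h1, hl]
        have hzero : joinExponent J l₀ e q 0 = ((Fintype.card β : ℝ) - 1 + e₀) / (q - 1) := by
          rw [joinExponent, classCount_succ J a g hg, classCount_zero]
          simp only [classCount_zero, e₀, eq_comm (a := 0) (b := l₀)]
          simp
        have hβ : (1 : ℝ) ≤ Fintype.card β := by
          have : Nonempty β := ⟨a r₀⟩
          exact_mod_cast Fintype.card_pos (α := β)
        have hΘ1 : ∑ l ∈ Finset.range (h + 1 + 1), joinExponent J l₀ e q l ≤ 1 := by
          rw [hΘ]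
          exact (div_le_one hq').2 (by linarith)
        have hblock : ∀ b, 0 ≤ 1 - ∑ l ∈ Finset.range (h + 1), θ b l := fun b => by
          rw [hθs, sub_nonneg]
          exact (div_le_one hq').2 (by linarith [htq b])
        rw [Finset.prod_mul_distrib, Finset.prod_comm, Finset.prod_range_succ' _ (h + 1),
          relMoment_zero, ← ENNReal.rpow_mul, ← mul_assoc, ← mul_assoc,
          ← ennreal_rpow_sum _ (fun b _ => hblock b),
          ← ENNReal.rpow_add_of_nonneg _ _ he₀' (Finset.sum_nonneg fun b _ => hblock b),
          mul_right_comm, ← ENNReal.rpow_add_of_nonneg]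
        · congr 1
          · congr 1
            -- The level-zero moment is `κ v ^ q`, and `(q - 1) θ 0 = card β - 1 + e₀` by `hzero`.
            -- Hence both sides carry `κ v` to the power `e₀ + ∑ b, (1 - ∑ l, θ b l)`.
            rw [Finset.sum_range_succ', hzero, Finset.sum_sub_distrib, Finset.sum_comm]
            simp only [hsucc]
            simp
            field_simp
            ring
          · refine Finset.prod_congr rfl fun l _ => ?_
            rw [hsucc, ennreal_rpow_sum _ fun b _ => hθ₀ b l]
        · linarith
        · rw [hzero]
          exact mul_nonneg (by linarith) (div_nonneg (by linarith) hq'.le)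

/-- The blocks of indices whose words have the same first letter. -/
theorem exists_blocks (J : ι → Level m (h + 1)) (r₀ : ι) :
    ∃ (β : Type) (_ : Fintype β) (a : ι → β) (g : β ↪ Fin m) (ρ : ∀ b, {r // a r = b}),
      (∀ r, (J r).head = g (a r)) ∧ ρ (a r₀) = ⟨r₀, rfl⟩ := by
  classical
  let β : Type := Set.range fun r => (J r).head
  let a : ι → β := fun r => ⟨(J r).head, r, rfl⟩
  have hsurj : ∀ b, Nonempty {r // a r = b} := by
    rintro ⟨_, r, rfl⟩
    exact ⟨⟨r, rfl⟩⟩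
  -- The representative of the marked block must be `r₀`, because the mark is recorded as a prefix
  -- of the word of `r₀`.
  exact ⟨β, inferInstance, a, Function.Embedding.subtype _,
    Function.update (fun b => (hsurj b).some) (a r₀) ⟨r₀, rfl⟩, fun r => rfl,
    Function.update_self _ _ _⟩

-- The index type, `v` and `e` vary because a block is a new tuple below a child and may carry no
-- mark. Only `card ι + e ≤ q` survives passage to blocks with `q` fixed; the power of `κ v` absorbs
-- the slack.
open Classical in
theorem IsCascade.sum_patternMoment_le (hw : IsCascade P w κ) {q : ℝ} (hq : 1 < q) (h : ℕ) :
    ∀ (ι : Type) [Fintype ι] (J : ι → Level m h) (r₀ : ι) (l₀ : ℕ) (_ : l₀ ≤ h) (e : ℝ)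
      (_ : 0 ≤ e) (_ : e ≤ 1) (_ : Fintype.card ι + e ≤ q) (v : Word m),
    ∑ K with SameShape J K, patternMoment P w κ e v K r₀ l₀ ≤
      κ v ^ (1 - ∑ l ∈ Finset.range (h + 1), joinExponent J l₀ e q l) *
        ∏ l ∈ Finset.range (h + 1), relMoment P w κ q v l ^ joinExponent J l₀ e q l := by
  have hq' : 0 < q - 1 := by linarith
  induction h with
  | zero =>
    intro ι _ J r₀ l₀ hl₀ e he₀ he₁ hle v
    have : Nonempty ι := ⟨r₀⟩
    have hcard : (1 : ℝ) ≤ Fintype.card ι := by exact_mod_cast Fintype.card_pos (α := ι)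
    have hθ := sum_joinExponent J hl₀ e q
    have h0 : 0 ≤ ((Fintype.card ι : ℝ) - 1 + e) / (q - 1) := div_nonneg (by linarith) hq'.le
    have h1 : ((Fintype.card ι : ℝ) - 1 + e) / (q - 1) ≤ 1 := (div_le_one hq').2 (by linarith)
    have hle1 : (Finset.univ.filter (SameShape J)).card ≤ 1 := Finset.card_le_one_of_subsingleton _
    have hR : κ v ^ (1 - ∑ l ∈ Finset.range (0 + 1), joinExponent J l₀ e q l) *
        ∏ l ∈ Finset.range (0 + 1), relMoment P w κ q v l ^ joinExponent J l₀ e q l =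
        κ v ^ ((Fintype.card ι : ℝ) + e) := by
      have hθ' : joinExponent J l₀ e q 0 = ((Fintype.card ι : ℝ) - 1 + e) / (q - 1) := by
        simpa using hθ
      rw [hθ, zero_add, Finset.prod_range_one, hθ', relMoment_zero, ← ENNReal.rpow_mul,
        ← ENNReal.rpow_add_of_nonneg _ _ (by linarith) (mul_nonneg (by linarith) h0)]
      congr 1
      field_simp
      ring
    rw [hR]
    refine (Finset.sum_le_card_nsmul _ _ _ fun K _ =>
      patternMoment_level_zero_le (P := P) (w := w) (κ := κ) he₀ v K r₀ l₀).trans ?_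
    calc _ ≤ 1 • κ v ^ ((Fintype.card ι : ℝ) + e) := by gcongr
      _ = _ := one_smul _ _
  | succ h ih =>
    intro ι _ J r₀ l₀ hl₀ e he₀ he₁ hle v
    obtain ⟨β, _, a, g, ρ, hg, hρ⟩ := exists_blocks J r₀
    exact hw.sum_patternMoment_succ_le hq J a g hg r₀ ρ hρ hl₀ he₀ he₁ hle v
      fun b η hη₀ hη₁ hη v => by
        convert ih {r // a r = b} (fun r => (J r).rest) (ρ b) (l₀ - 1)
          (Nat.sub_le_of_le_add hl₀) η hη₀ hη₁ hη v

end Induction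

/-! ### Meets and agreement of prefixes -/

section Meet

variable {m : ℕ}

theorem meet_prefix_left : ∀ i j : Word m, meet i j <+: i
  | [], _ => by simp [meet]
  | a :: i, [] => by simp [meet]
  | a :: i, b :: j => by
    rw [meet]
    split_ifs with h
    · exact List.cons_prefix_cons.2 ⟨rfl, meet_prefix_left i j⟩
    · exact List.nil_prefix

theorem meet_eq_take (i j : Word m) : meet i j = i.take (meet i j).length :=
  List.prefix_iff_eq_take.1 (meet_prefix_left i j)

/-- The bound on `l` matters: `take` saturates beyond the end of a word. -/
theorem take_eq_take_iff : ∀ (i j : Word m) (l : ℕ), i.length = j.length → l ≤ i.length →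
    (i.take l = j.take l ↔ l ≤ (meet i j).length)
  | [], j, l, _, hl => by
    have : l = 0 := by simpa using hl
    simp [this]
  | a :: i, [], l, hij, _ => by simp at hij
  | a :: i, b :: j, 0, _, _ => by simp
  | a :: i, b :: j, l + 1, hij, hl => by
    rw [meet]
    have := take_eq_take_iff i j l (by simpa using hij) (by simpa using hl)
    split_ifs with h
    · simp [h, this]
    · simp [h]

end Meet

/-! ### Rooted automorphisms preserve shape and mark -/

section Automorphisms

variable {m k : ℕ}

theorem treeGraph_adj_append (u : Word m) (a : Fin m) (hu : (u ++ [a]).length ≤ k) :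
    (treeGraph m k).Adj ⟨u, by simp at hu; omega⟩ ⟨u ++ [a], hu⟩ := by
  rw [treeGraph, SimpleGraph.fromRel_adj]
  refine ⟨fun h => ?_, Or.inl ⟨a, rfl⟩⟩
  simpa using congrArg (fun v => v.1.length) h

theorem treeGraph_adj_cases {u v : Vertex m k} (h : (treeGraph m k).Adj u v) :
    (∃ a, v.1 = u.1 ++ [a]) ∨ ∃ a, u.1 = v.1 ++ [a] := by
  rw [treeGraph, SimpleGraph.fromRel_adj] at h
  exact h.2

variable (g : treeGraph m k ≃g treeGraph m k)

/-- The image of a child of `u` is a neighbour of the image of `u`. It is not the parent: the root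
has none, and otherwise, by induction, that parent is the image of the parent of `u`, so injectivity
excludes it. -/
theorem automorphism_child (hg : g (root m k) = root m k) (u : Word m) :
    ∀ (a : Fin m) (hu : (u ++ [a]).length ≤ k),
      ∃ b, (g ⟨u ++ [a], hu⟩).1 = (g ⟨u, by simp at hu; omega⟩).1 ++ [b] := by
  induction u using List.reverseRecOn with
  | nil =>
    intro a hu
    rcases treeGraph_adj_cases (g.map_adj_iff.2 (treeGraph_adj_append [] a hu)) with h | ⟨b, h⟩
    · exact h
    · have h0 : (g ⟨[], Nat.zero_le k⟩).1 = [] := congrArg Subtype.val hg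
      simp [h0] at h
  | append_singleton u c ih =>
    intro a hu
    rcases treeGraph_adj_cases (g.map_adj_iff.2 (treeGraph_adj_append (u ++ [c]) a hu)) with
      h | ⟨b, h⟩
    · exact h
    · obtain ⟨d, hd⟩ := ih c (by simp at hu ⊢; omega)
      rw [hd] at h
      have h1 := g.injective (Subtype.ext (List.append_inj_left' h rfl))
      have h2 := congrArg (fun v => v.1.length) h1
      simp at h2

theorem automorphism_length (hg : g (root m k) = root m k) (u : Word m) (hu : u.length ≤ k) :
    (g ⟨u, hu⟩).1.length = u.length := by
  induction u using List.reverseRecOn with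
  | nil =>
    have h0 : (g ⟨[], hu⟩).1 = [] := congrArg Subtype.val hg
    simp [h0]
  | append_singleton u c ih =>
    obtain ⟨d, hd⟩ := automorphism_child g hg u c hu
    rw [hd, List.length_append, ih, List.length_append, List.length_singleton,
      List.length_singleton]

theorem automorphism_take (hg : g (root m k) = root m k) (u : Word m) (hu : u.length ≤ k) (s : ℕ)
    (y : Vertex m k) (hy : y.1 = u.take s) : (g y).1 = (g ⟨u, hu⟩).1.take s := by
  induction u using List.reverseRecOn with
  | nil =>
    have h0 : (g ⟨[], hu⟩).1 = [] := congrArg Subtype.val hg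
    obtain rfl : y = ⟨[], hu⟩ := Subtype.ext (by simpa using hy)
    simp [h0]
  | append_singleton u c ih =>
    have hu' : u.length ≤ k := by simp at hu; omega
    rcases Nat.lt_or_ge u.length s with hs | hs
    · have h1 : (u ++ [c]).length ≤ s := by simp; omega
      obtain rfl : y = ⟨u ++ [c], hu⟩ := Subtype.ext (by rw [hy, List.take_of_length_le h1])
      rw [List.take_of_length_le]
      rwa [automorphism_length g hg]
    · obtain ⟨d, hd⟩ := automorphism_child g hg u c hu
      rw [hd, List.take_append_of_le_length]
      · exact ih hu' (hy.trans (List.take_append_of_le_length hs))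
      · rwa [automorphism_length g hg]

variable {n : ℕ} {J K : MarkedTuple m k n}

theorem MarkedTuple.Equivalent.sameShape (h : J.Equivalent K) : SameShape J.leaves K.leaves := by
  obtain ⟨g, hg, hleaves, -⟩ := h
  intro l r s
  let x : Fin n → Vertex m k := fun r => ⟨(J.leaves r).toList.take l,
    (List.length_take_le' l _).trans (List.Vector.toList_length _).le⟩
  have h1 : ∀ r, (K.leaves r).toList.take l = (g (x r)).1 := fun r => by
    rw [automorphism_take g hg _ (J.leaves r).toVertex.2 l (x r) rfl]
    exact congrArg (fun v => v.1.take l) (hleaves r).symm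
  rw [h1, h1, Subtype.val_inj, g.injective.eq_iff, Subtype.mk.injEq]

/-- Automorphisms commute with truncation, so within an orbit the leaves determine the mark. -/
theorem MarkedTuple.Equivalent.mark_eq (h : J.Equivalent K) {r : Fin n}
    (hr : J.mark.1 <+: (J.leaves r).toList) :
    K.mark.1 = (K.leaves r).toList.take J.mark.1.length := by
  obtain ⟨g, hg, hleaves, hmark⟩ := h
  rw [← hmark, automorphism_take g hg _ (J.leaves r).toVertex.2 J.mark.1.length J.mark
    (List.prefix_iff_eq_take.1 hr)]
  exact congrArg (fun v => v.1.take J.mark.1.length) (hleaves r)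

/-- By maximality of the branching level, the next vertex on the path to `j`, if there is one, is
outside the tree. -/
theorem meetTree_eq_imp {i : Fin n → Level m k} {r₀ : Fin n} {l₀ : ℕ} (hl₀ : l₀ ≤ k)
    {j : Level m k} (h : meetTree j.toList i = (i r₀).toList.take l₀) : j ∈ offMark i r₀ l₀ := by
  classical
  simp only [offMark, Finset.mem_filter, Finset.mem_univ, true_and]
  rw [meetTree] at h
  set s := Nat.findGreatest (fun s => j.toList.take s ∈ spanTree i) j.toList.length with hs
  have hsk : s ≤ j.toList.length := Nat.findGreatest_le _
  have hsl : s = l₀ := by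
    have := congrArg List.length h
    simp only [List.length_take, List.Vector.toList_length] at this hsk
    omega
  subst hsl
  refine ⟨h, fun hlt r hr => ?_⟩
  refine Nat.findGreatest_is_greatest (P := fun s => j.toList.take s ∈ spanTree i)
    (n := j.toList.length) (k := s + 1) (by omega) (by simpa using hlt) ?_
  exact Or.inr ⟨r, hr ▸ List.take_prefix _ _⟩

end Automorphisms

/-! ### Join multiplicities as jumps of the vertex count -/

section Joins

variable {m k n : ℕ} (i : Fin n → Level m k)

/-- The number of children of `u` in the tree spanned by `i`, indices counting as children of the
bottom vertices. -/
def childCount (u : Word m) : ℕ :=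
  ((Finset.univ.filter fun r => (i r).toList.take u.length = u).image
    (levelKey i (u.length + 1))).card

/-- Two words meet at `u` when both pass through `u` and continue to different children. Counting
indices as children of bottom vertices covers repeated words. -/
theorem meet_eq_iff {r s : Fin n} (hrs : r ≠ s) {u : Word m} (hu : u.length ≤ k) :
    meet (i r).toList (i s).toList = u ↔ (i r).toList.take u.length = u ∧
      (i s).toList.take u.length = u ∧
      levelKey i (u.length + 1) r ≠ levelKey i (u.length + 1) s := by
  have hk : ∀ l ≤ k, ((i r).toList.take l = (i s).toList.take l ↔
      l ≤ (meet (i r).toList (i s).toList).length) := fun l hl =>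
    take_eq_take_iff _ _ l (by simp) (by simpa using hl)
  have hlen : (meet (i r).toList (i s).toList).length ≤ k := by
    simpa using (meet_prefix_left (i r).toList (i s).toList).length_le
  have hkey : levelKey i (u.length + 1) r = levelKey i (u.length + 1) s ↔
      u.length + 1 ≤ (meet (i r).toList (i s).toList).length := by
    by_cases h : u.length + 1 ≤ k
    · simp [levelKey, h, hk _ h]
    · simp only [levelKey, h, if_false, Prod.mk.injEq, Option.some.injEq, hrs, and_false,
        false_iff]
      omega
  rw [ne_eq, hkey]
  constructor
  · intro h
    have h1 : (i r).toList.take u.length = u := by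
      conv_rhs => rw [← h, meet_eq_take, h]
    refine ⟨h1, ?_, by rw [h]; omega⟩
    rw [← (hk _ hu).2 (by rw [h]), h1]
  · rintro ⟨hr, hs, hne⟩
    have := (hk _ hu).1 (hr.trans hs.symm)
    rw [meet_eq_take, show (meet (i r).toList (i s).toList).length = u.length by omega, hr]

theorem one_le_childCount {u : Word m} {r : Fin n} (hr : (i r).toList.take u.length = u) :
    1 ≤ childCount i u := by
  classical
  exact Finset.card_pos.2 ⟨_, Finset.mem_image_of_mem _ (Finset.mem_filter.2
    ⟨Finset.mem_univ r, hr⟩)⟩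

/-- A set of at least two indices meets pairwise at `u` exactly when its words pass through `u` into
distinct children, so the largest has one index per child. Smaller sets qualify vacuously, and `u`
has at least one child. -/
theorem joinMultiplicity_eq {u : Word m} (hu : u.length ≤ k) {r : Fin n}
    (hr : (i r).toList.take u.length = u) : joinMultiplicity i u = childCount i u - 1 := by
  classical
  rw [joinMultiplicity]
  congr 1
  apply le_antisymm
  · refine Finset.sup_le fun A hA => ?_
    have hA := (Finset.mem_filter.1 hA).2
    rcases Nat.lt_or_ge 1 A.card with hc | hc
    · rw [childCount, ← Finset.card_image_of_injOn (s := A) (f := levelKey i (u.length + 1))]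
      · refine Finset.card_le_card (Finset.image_subset_image fun s hs => ?_)
        obtain ⟨t, ht, hts⟩ := Finset.exists_mem_ne hc s
        exact Finset.mem_filter.2 ⟨Finset.mem_univ s,
          ((meet_eq_iff i hts hu).1 (hA t ht s hs hts)).2.1⟩
      · intro s hs t ht hst
        by_contra hne
        exact ((meet_eq_iff i hne hu).1 (hA s hs t ht hne)).2.2 hst
    · exact hc.trans (one_le_childCount i hr)
  · obtain ⟨A, hAs, hinj, hAim⟩ := Finset.exists_subset_injOn_image_eq_of_surjOn
      (f := levelKey i (u.length + 1)) {r | (i r).toList.take u.length = u}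
      ((Finset.univ.filter fun r => (i r).toList.take u.length = u).image
        (levelKey i (u.length + 1))) (by simpa using Set.surjOn_image _ _)
    rw [childCount, ← hAim, Finset.card_image_of_injOn hinj]
    refine Finset.le_sup (f := Finset.card) (Finset.mem_filter.2 ⟨Finset.mem_univ A, ?_⟩)
    exact fun s hs t ht hst => (meet_eq_iff i hst hu).2
      ⟨hAs hs, hAs ht, fun h => hst (hinj hs ht h)⟩

theorem joinMultiplicity_eq_zero {u : Word m}
    (hu : u ∉ (Finset.univ : Finset (Fin n)).offDiag.image
      fun rs => meet (i rs.1).toList (i rs.2).toList) : joinMultiplicity i u = 0 := by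
  classical
  rw [joinMultiplicity, Nat.sub_eq_zero_iff_le]
  refine Finset.sup_le fun A hA => Finset.card_le_one.2 fun r hr s hs => ?_
  by_contra hrs
  exact hu (Finset.mem_image.2 ⟨(r, s), by simpa using hrs,
    (Finset.mem_filter.1 hA).2 r hr s hs hrs⟩)

theorem classCount_eq_card (l : ℕ) :
    classCount i l = (Finset.univ.image (levelKey i l)).card := by
  rw [classCount]
  congr!

theorem classCount_eq_prefixes {l : ℕ} (hl : l ≤ k) :
    classCount i l = (Finset.univ.image fun r => (i r).toList.take l).card := by
  have hkey : levelKey i l =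
      (fun u : Word m => (u, (none : Option (Fin n)))) ∘ fun r => (i r).toList.take l := by
    funext r
    simp [levelKey, hl]
  rw [classCount_eq_card, hkey, ← Finset.image_image]
  exact Finset.card_image_of_injective _ fun u v h => (Prod.mk.inj h).1

theorem classCount_succ_eq_sum {l : ℕ} (hl : l ≤ k) :
    classCount i (l + 1) = ∑ u ∈ Finset.univ.image fun r => (i r).toList.take l, childCount i u := by
  rw [classCount_eq_card, Finset.card_eq_sum_card_fiberwise (f := fun x => x.1.take l)
    (t := Finset.univ.image fun r => (i r).toList.take l)]
  · refine Finset.sum_congr rfl fun u hu => ?_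
    obtain ⟨r, -, rfl⟩ := Finset.mem_image.1 hu
    have hlen : ((i r).toList.take l).length = l := by simpa using hl
    rw [childCount, hlen, Finset.filter_image]
    simp [levelKey, List.take_take]
  · intro x hx
    obtain ⟨r, -, rfl⟩ := Finset.mem_image.1 (Finset.mem_coe.1 hx)
    exact Finset.mem_coe.2 (Finset.mem_image.2 ⟨r, Finset.mem_univ r, by
      simp [levelKey, List.take_take]⟩)

/-- A vertex with `c` children contributes `c - 1`, which is `0` if it is not a join point; summing
over level `l` gives the jump of the count. -/
theorem sum_joinMultiplicity {l : ℕ} (hl : l ≤ k) :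
    ∑ u ∈ (Finset.univ : Finset (Fin n)).offDiag.image
      (fun rs => meet (i rs.1).toList (i rs.2).toList) with u.length = l, joinMultiplicity i u =
      classCount i (l + 1) - classCount i l := by
  classical
  have hlen : ∀ r, ((i r).toList.take l).length = l := fun r => by simpa using hl
  rw [classCount_succ_eq_sum i hl, classCount_eq_prefixes i hl, Finset.card_eq_sum_ones,
    ← Finset.sum_tsub_distrib]
  · trans ∑ u ∈ Finset.univ.image fun r => (i r).toList.take l, joinMultiplicity i u
    · refine Finset.sum_subset (fun u hu => ?_) fun u hu hu' => joinMultiplicity_eq_zero i fun h => ?_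
      · obtain ⟨hu, hul⟩ := Finset.mem_filter.1 hu
        obtain ⟨⟨r, s⟩, -, rfl⟩ := Finset.mem_image.1 hu
        refine Finset.mem_image.2 ⟨r, Finset.mem_univ r, ?_⟩
        rw [← hul]
        exact (meet_eq_take _ _).symm
      · obtain ⟨r, -, rfl⟩ := Finset.mem_image.1 hu
        exact hu' (Finset.mem_filter.2 ⟨h, hlen r⟩)
    · refine Finset.sum_congr rfl fun u hu => ?_
      obtain ⟨r, -, rfl⟩ := Finset.mem_image.1 hu
      exact joinMultiplicity_eq i (by rw [hlen]; exact hl) (r := r) (by rw [hlen])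
  · intro u hu
    obtain ⟨r, -, rfl⟩ := Finset.mem_image.1 hu
    exact one_le_childCount i (r := r) (by rw [hlen])

theorem joinLevels_eq : joinLevels i = ∑ l ∈ Finset.range (k + 1),
    Multiset.replicate (classCount i (l + 1) - classCount i l) l := by
  classical
  have hmap : joinLevels i = ∑ u ∈ (Finset.univ : Finset (Fin n)).offDiag.image
      (fun rs => meet (i rs.1).toList (i rs.2).toList),
      Multiset.replicate (joinMultiplicity i u) u.length := by
    rw [joinLevels, joinSet, ← Multiset.coe_mapAddMonoidHom, map_sum]
    simp
  rw [hmap, ← Finset.sum_fiberwise_of_maps_to (g := List.length) (t := Finset.range (k + 1))]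
  · refine Finset.sum_congr rfl fun l hl => ?_
    rw [← sum_joinMultiplicity i (Nat.lt_succ_iff.1 (Finset.mem_range.1 hl))]
    refine (Finset.sum_congr rfl fun u hu => by rw [(Finset.mem_filter.1 hu).2]).trans ?_
    exact (map_sum (Multiset.replicateAddMonoidHom l) _ _).symm
  · intro u hu
    obtain ⟨⟨r, s⟩, -, rfl⟩ := Finset.mem_image.1 hu
    have := (meet_prefix_left (i r).toList (i s).toList).length_le
    simp only [List.Vector.toList_length] at this
    exact Finset.mem_range.2 (Nat.lt_succ_of_le this)

theorem card_joinLevels (r₀ : Fin n) : (joinLevels i).card + 1 = n := by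
  have : Nonempty (Fin n) := ⟨r₀⟩
  have hmono : Monotone (classCount i) := monotone_nat_of_le_succ (classCount_le_succ i)
  rw [joinLevels_eq, Multiset.card_sum]
  simp only [Multiset.card_replicate]
  rw [Finset.sum_range_tsub hmono, classCount_last, classCount_zero, Fintype.card_fin]
  have := r₀.pos
  omega

theorem prod_joinLevels (F : ℕ → ℝ≥0∞) : ((joinLevels i).map F).prod =
    ∏ l ∈ Finset.range (k + 1), F l ^ (classCount i (l + 1) - classCount i l) := by
  rw [joinLevels_eq, ← Multiset.coe_mapAddMonoidHom, map_sum, Multiset.prod_sum]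
  simp

end Joins

/-! ### Additivity of the measure on cylinders -/

section Cylinders

variable {m : ℕ}

theorem mem_cylinder_append_singleton (v : Word m) (c : Fin m) (x : ℕ → Fin m) :
    x ∈ cylinder (v ++ [c]) ↔ x v.length = c ∧ x ∈ cylinder v := by
  simp only [cylinder, Set.mem_ofPred_eq, List.get_eq_getElem, Fin.forall_iff, List.length_append,
    List.length_singleton]
  constructor
  · intro h
    refine ⟨by simpa using h v.length (by omega), fun r hr => ?_⟩
    rw [h r (by omega), List.getElem_append_left hr]
  · rintro ⟨hc, h⟩ r hr
    rcases Nat.lt_or_ge r v.length with hr' | hr'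
    · rw [List.getElem_append_left hr', h r hr']
    · obtain rfl : r = v.length := by omega
      simpa using hc

theorem sum_measure_cylinder (μ : Measure (ℕ → Fin m)) (v : Word m) :
    ∑ c, μ (cylinder (v ++ [c])) = μ (cylinder v) := by
  have hmeas : ∀ c : Fin m, MeasurableSet ((fun x : ℕ → Fin m => x v.length) ⁻¹' {c}) :=
    fun c => measurable_pi_apply v.length (measurableSet_singleton c)
  have h := sum_measure_preimage_singleton (μ := μ.restrict (cylinder v)) Finset.univ
    (fun c _ => hmeas c)
  rw [Finset.coe_univ, Set.preimage_univ, Measure.restrict_apply_univ] at h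
  rw [← h]
  refine Finset.sum_congr rfl fun c _ => ?_
  rw [Measure.restrict_apply (hmeas c)]
  congr 1
  ext x
  exact mem_cylinder_append_singleton v c x

end Cylinders

/-! ### Real products as extended nonnegative masses -/

section Pointwise

variable {m : ℕ} {Ω : Type*} {W : Word m → Ω → ℝ} {μ : Measure (ℕ → Fin m)}

theorem relMass_eq_prod (w : Word m → Ω → ℝ≥0∞) (κ : Word m → ℝ≥0∞) (v u : Word m)
    (ω : Ω) : relMass w κ v u ω =
      (∏ r ∈ Finset.range u.length, w (v ++ u.take (r + 1)) ω) * κ (v ++ u) := by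
  induction u generalizing v with
  | nil => simp [relMass]
  | cons a u ih =>
    rw [relMass, ih, List.length_cons, Finset.prod_range_succ']
    simp only [List.take_succ_cons, List.append_assoc, List.singleton_append, List.take_zero]
    ring

theorem Y_nonneg {ω : Ω} (hω : ∀ v, 0 < W v ω) (v : Word m) : 0 ≤ Y W μ v ω :=
  mul_nonneg (Finset.prod_nonneg fun _ _ => (hω _).le) measureReal_nonneg

theorem ofReal_Y [IsFiniteMeasure μ] {ω : Ω} (hω : ∀ v, 0 < W v ω) (v : Word m) :
    ENNReal.ofReal (Y W μ v ω) =
      relMass (fun v ω => ENNReal.ofReal (W v ω)) (fun v => μ (cylinder v)) [] v ω := by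
  rw [relMass_eq_prod, Y, X, ENNReal.ofReal_mul (Finset.prod_nonneg fun _ _ => (hω _).le),
    ENNReal.ofReal_prod_of_nonneg fun _ _ => (hω _).le, ofReal_measureReal]
  simp

end Pointwise

/-! ### From real weights and orbits to cascades and shapes -/

section Transfer

variable {m : ℕ} {Ω : Type*} [MeasurableSpace Ω] {P : Measure Ω} {W : Word m → Ω → ℝ}
  {μ : Measure (ℕ → Fin m)}

theorem isCascade_ofReal (hW_meas : ∀ v, Measurable (W v)) (hW_indep : iIndepFun W P)
    (hW_pos : ∀ v, ∀ᵐ ω ∂P, 0 < W v ω) (hW_mean : ∀ v, ∫ ω, W v ω ∂P = 1) :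
    IsCascade P (fun v ω => ENNReal.ofReal (W v ω)) (fun v => μ (cylinder v)) where
  meas v := (hW_meas v).ennreal_ofReal
  indep := hW_indep.comp (fun _ => ENNReal.ofReal) fun _ => ENNReal.measurable_ofReal
  mean v := by
    -- A non-integrable function would have integral `0`, not `1`.
    have hint : Integrable (W v) P := by
      by_contra h
      simpa [integral_undef h] using hW_mean v
    rw [← ofReal_integral_eq_lintegral_ofReal hint ((hW_pos v).mono fun _ h => h.le), hW_mean,
      ENNReal.ofReal_one]
  additive := sum_measure_cylinder μ

theorem levelMoment_eq [IsFiniteMeasure μ] (hW_pos : ∀ v, ∀ᵐ ω ∂P, 0 < W v ω) {q : ℝ}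
    (hq : 0 ≤ q) (l : ℕ) : levelMoment P W μ q l =
      relMoment P (fun v ω => ENNReal.ofReal (W v ω)) (fun v => μ (cylinder v)) q [] l := by
  refine Finset.sum_congr rfl fun u _ => lintegral_congr_ae ?_
  -- There are countably many words, so one null set serves for all of them.
  filter_upwards [ae_all_iff.2 hW_pos] with ω hω
  rw [← ENNReal.ofReal_rpow_of_nonneg (Y_nonneg hω _) hq, ofReal_Y hω]

theorem expect_le_patternMoment [IsFiniteMeasure μ] (hW_pos : ∀ v, ∀ᵐ ω ∂P, 0 < W v ω) {k n : ℕ}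
    {ε : ℝ} (hε : 0 ≤ ε) (i : Fin n → Level m k) (r₀ : Fin n) {l₀ : ℕ} (hl₀ : l₀ ≤ k) :
    expect P (fun ω => (∏ r, Y W μ (i r).toList ω) *
      (∑ j : Level m k with meetTree j.toList i = (i r₀).toList.take l₀, Y W μ j.toList ω) ^ ε) ≤
      patternMoment P (fun v ω => ENNReal.ofReal (W v ω)) (fun v => μ (cylinder v)) ε [] i
        r₀ l₀ := by
  refine lintegral_mono_ae ?_
  filter_upwards [ae_all_iff.2 hW_pos] with ω hω
  rw [ENNReal.ofReal_mul (Finset.prod_nonneg fun _ _ => Y_nonneg hω _),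
    ENNReal.ofReal_prod_of_nonneg fun _ _ => Y_nonneg hω _,
    ← ENNReal.ofReal_rpow_of_nonneg (Finset.sum_nonneg fun _ _ => Y_nonneg hω _) hε,
    ENNReal.ofReal_sum_of_nonneg fun _ _ => Y_nonneg hω _]
  simp only [ofReal_Y hω]
  refine mul_le_mul_right (ENNReal.rpow_le_rpow (Finset.sum_le_sum_of_subset fun j hj => ?_) hε) _
  exact meetTree_eq_imp hl₀ (Finset.mem_filter.1 hj).2

open Classical in
/-- The members of an orbit are determined by their leaves, which have the shape of those of `J`. -/
theorem sum_orbit_le {k n : ℕ} (J : MarkedTuple m k n) {r₀ : Fin n}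
    (hr₀ : J.mark.1 <+: (J.leaves r₀).toList) (G : MarkedTuple m k n → ℝ≥0∞)
    (F : (Fin n → Level m k) → ℝ≥0∞)
    (hGF : ∀ K : MarkedTuple m k n, K.mark.1 = (K.leaves r₀).toList.take J.mark.1.length →
      G K ≤ F K.leaves) :
    ∑ K ∈ J.orbit, G K ≤ ∑ i with SameShape J.leaves i, F i := by
  have horbit : ∀ K ∈ J.orbit, J.Equivalent K := fun K hK => (Finset.mem_filter.1 hK).2
  have hinj : Set.InjOn MarkedTuple.leaves (J.orbit : Set (MarkedTuple m k n)) := by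
    intro K hK L hL hKL
    refine Subtype.ext (Prod.ext hKL (Subtype.ext ?_))
    change K.mark.1 = L.mark.1
    rw [(horbit K hK).mark_eq hr₀, (horbit L hL).mark_eq hr₀, hKL]
  calc ∑ K ∈ J.orbit, G K ≤ ∑ K ∈ J.orbit, F K.leaves :=
        Finset.sum_le_sum fun K hK => hGF K ((horbit K hK).mark_eq hr₀)
    _ = ∑ i ∈ J.orbit.image MarkedTuple.leaves, F i := (Finset.sum_image hinj).symm
    _ ≤ ∑ i with SameShape J.leaves i, F i := by
        refine Finset.sum_le_sum_of_subset fun i hi => ?_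
        obtain ⟨K, hK, rfl⟩ := Finset.mem_image.1 hi
        exact Finset.mem_filter.2 ⟨Finset.mem_univ _, (horbit K hK).sameShape⟩

theorem prod_rpow_joinExponent {k n : ℕ} (i : Fin n → Level m k) {l₀ : ℕ} (hl₀ : l₀ ≤ k) {ε q : ℝ}
    (hε : 0 ≤ ε) (hq : 1 < q) (A : ℕ → ℝ≥0∞) :
    ∏ l ∈ Finset.range (k + 1), A l ^ joinExponent i l₀ ε q l =
      ((joinLevels i).map fun l => A l ^ (1 / (q - 1))).prod * A l₀ ^ (ε / (q - 1)) := by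
  have hq' : 0 < q - 1 := by linarith
  have hmark : A l₀ ^ (ε / (q - 1)) =
      ∏ l ∈ Finset.range (k + 1), A l ^ ((if l = l₀ then ε else 0) / (q - 1)) := by
    rw [Finset.prod_eq_single l₀]
    · simp
    · intro l _ hl
      simp [hl]
    · intro h
      exact absurd (Finset.mem_range.2 (Nat.lt_succ_of_le hl₀)) h
  rw [prod_joinLevels, hmark, ← Finset.prod_mul_distrib]
  refine Finset.prod_congr rfl fun l _ => ?_
  have h0 : (0 : ℝ) ≤ if l = l₀ then ε else 0 := by split_ifs; exacts [hε, le_rfl]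
  rw [← ENNReal.rpow_natCast, ← ENNReal.rpow_mul, Nat.cast_sub (classCount_le_succ i l),
    ← ENNReal.rpow_add_of_nonneg _ _ _ (div_nonneg h0 hq'.le), joinExponent]
  · congr 1
    ring
  · exact mul_nonneg (by positivity)
      (sub_nonneg.2 (by exact_mod_cast classCount_le_succ i l))

end Transfer

end Cascade

/-! ### The proposition, from the case of the root -/

theorem proposition3p1 {Ω : Type*} [MeasurableSpace Ω] (P : Measure Ω) [IsProbabilityMeasure P]
    (m k : ℕ) (hm : 2 ≤ m) (hk : 1 ≤ k)
    (W : Cascade.Word m → Ω → ℝ) (hW_meas : ∀ v, Measurable (W v)) (hW_indep : iIndepFun W P)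
    (hW_pos : ∀ v, ∀ᵐ ω ∂P, 0 < W v ω) (hW_mean : ∀ v, ∫ ω, W v ω ∂P = 1)
    (μ : Measure (ℕ → Fin m)) [IsProbabilityMeasure μ]
    (n : ℕ) (ε q : ℝ) (hε₀ : 0 ≤ ε) (hε₁ : ε < 1) (hq : q = n + ε) (hq₁ : 1 < q)
    (J : Cascade.MarkedTuple m k n) :
    Multiset.card (Cascade.joinLevels J.leaves) + 1 = n ∧
    ∑ K ∈ J.orbit, Cascade.expect P (fun ω =>
        (∏ r, Cascade.Y W μ (K.leaves r).toList ω) *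
          (∑ j : Cascade.Level m k with Cascade.meetTree j.toList K.leaves = K.mark.1,
            Cascade.Y W μ j.toList ω) ^ ε) ≤
      ((Cascade.joinLevels J.leaves).map fun l =>
          Cascade.levelMoment P W μ q l ^ (1 / (q - 1))).prod *
        Cascade.levelMoment P W μ q J.mark.1.length ^ (ε / (q - 1)) := by
  have hn : 0 < n := by
    rcases Nat.eq_zero_or_pos n with rfl | h
    · simp only [Nat.cast_zero, zero_add] at hq
      linarith
    · exact h
  -- A leaf below the mark lets the mark be encoded by an index and a level; for the root any index
  -- will do, and `n > 0` supplies one.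
  obtain ⟨r₀, hr₀⟩ : ∃ r₀, J.mark.1 <+: (J.leaves r₀).toList := by
    rcases J.2 with h | h
    · refine ⟨⟨0, hn⟩, ?_⟩
      change J.mark.1 = [] at h
      rw [h]
      exact List.nil_prefix
    · exact h
  refine ⟨Cascade.card_joinLevels J.leaves r₀, ?_⟩
  have hl₀ : J.mark.1.length ≤ k := J.mark.2
  have hw := Cascade.isCascade_ofReal (μ := μ) hW_meas hW_indep hW_pos hW_mean
  have hmain := hw.sum_patternMoment_le hq₁ k (Fin n) J.leaves r₀ J.mark.1.length hl₀ ε hε₀ hε₁.le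
    (by rw [Fintype.card_fin, hq]) []
  have hroot : μ (Cascade.cylinder []) = 1 := by
    rw [show Cascade.cylinder ([] : Cascade.Word m) = Set.univ from
      Set.eq_univ_of_forall fun x r => r.elim0, measure_univ]
  rw [hroot, ENNReal.one_rpow, one_mul, Cascade.prod_rpow_joinExponent J.leaves hl₀ hε₀ hq₁] at hmain
  simp only [Cascade.levelMoment_eq hW_pos (zero_le_one.trans hq₁.le)]
  refine le_trans (Cascade.sum_orbit_le J hr₀ _ (fun i => Cascade.patternMoment P
    (fun v ω => ENNReal.ofReal (W v ω)) (fun v => μ (Cascade.cylinder v)) ε [] i r₀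
      J.mark.1.length) fun K hK => ?_) (le_of_eq_of_le ?_ hmain)
  · rw [hK]
    exact Cascade.expect_le_patternMoment hW_pos hε₀ K.leaves r₀ hl₀
  · congr!
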